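/- **Setting.** Let $R,S\in(0,\infty)\setminus\{1\}$, $\delta,r,\mu\in\mathbb R$, $\sigma>0$, and put $\lambda=\frac{\mu-r}{\sigma}$, $\alpha=\delta-r(1-S)$, $q_M=\frac{\lambda}{\sigma R}$, $$m(q)=\tfrac{\alpha}{S}-\tfrac{1-S}{S}\lambda\sigma q+R\tfrac{1-S}{S}\tfrac{\sigma^2}{2}q^2,\qquad \ell(q)=\tfrac{\alpha}{S}-\tfrac{1-S}{S}\big(\lambda\sigma-\tfrac{\sigma^2}{2}\big)q-(1-R)\tfrac{1-S}{S}\tfrac{\sigma^2}{2}q^2,$$ $\hat m=m(q_M)$, $\Delta=\frac{3q_M^2(1-q_M)^2}{4R}$, $h_3(v)=(1+v)^2(2-v)$ and $\tau_c(q)=\frac{cq}{1+(c-1)q}$. An Epstein–Zin agent (risk aversion $R$, elasticity of intertemporal complementarity $S$, discount parameter $\delta$) trades a bond with rate $r$ and a stock with drift $\mu$ and volatility $\sigma$; buying a share costs $\gamma^\uparrow y$ and selling it yields $y/\gamma^\downarrow$ when the stock price is $y$. For $\gamma^\uparrow,\gamma^\downarrow\ge 1$ with $\xi=\gamma^\uparrow\gamma^\downarrow>1$,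 the optimal behaviour is described by the following data. * Free boundaries $q_*<q^*$ with: $0<q_*<q_M<q^*<1$ if $q_M\in(0,1)$; $0<q_*<q^*=1$ if $q_M=1$; $0<q_*<q_M<q^*<2q_M-1$ if $q_M>1$; $2q_M<q_*<q_M<q^*<0$ if $q_M<0$. Further, a $C^1$ function $n:[q_*,q^*]\to(0,\infty)$, decreasing if $(1-R)q_M>0$ and increasing if $(1-R)q_M<0$, with $n\ne\ell$ and $n'=\frac{1-S}{S}\frac{n}{1-q}\frac{m-n}{\ell-n}$ off $q=1$, $n=m$ and $n'=0$ at $q_*$ and $q^*$, $n(1)=m(1)$ and $n'(1)=m'(1)$ if $1\in[q_*,q^*]$, and $\xi=\exp\big(\int_{q_*}^{q^*}-\frac{1}{q(1-q)}\frac{m-n}{\ell-n}\,dq\big)$. * A decreasing $C^1$ function $\kappa:[q_*,q^*]\to(0,\infty)$ with $\kappa'=\frac{\kappa}{q(1-q)}\frac{m-n}{\ell-n}$ off $q=1$, $\kappa(q_*)=\gamma^\uparrow$, $\kappa(q^*)=1/\gamma^\downarrow$, $\kappa'(q_*)=\kappa'(q^*)=0$. * With $p_*=\tau_{1/\gamma^\uparrow}(q_*)<p^*=\tau_{\gamma^\downarrow}(q^*)$,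 an increasing $C^1$ function $q(\cdot):[p_*,p^*]\to[q_*,q^*]$ with $q'(p)=\frac{\ell(q(p))-n(q(p))}{\ell(p)-m(p)}$ off $p=1$, $q(p_*)=q_*$, $q(p^*)=q^*$, $q'(p_*)=\tau_{\gamma^\uparrow}'(p_*)$, $q'(p^*)=\tau_{1/\gamma^\downarrow}'(p^*)$, and $q(1)=1$ if $1\in[p_*,p^*]$. Let $(x,y,\phi)$ (cash, stock price, number of shares) lie in the interior of the solvency region, i.e. $y>0$ and $x+\frac1{\gamma^\downarrow}\phi^+y-\gamma^\uparrow\phi^-y>0$, and let $p=\frac{y\phi}{x+y\phi}$ lie in the no-transaction region $[p_*,p^*]$. The optimal consumption, in feedback form, is $$C^*_{\gamma^\uparrow,\gamma^\downarrow}(t,x,y,\phi)=\big(x+\phi y\,\kappa(q(p))\big)\,n(q(p)),$$ and the optimal consumption without transaction costs is $C^*_{1,1}(t,x,y,\phi)=(x+y\phi)\hat m$. **Proposition.** Suppose that either $R,S<1$ and $\hat m\ge0$, or $R,S>1$ and $\hat m>0$, and that $q_M\notin\{0,1\}$. There are $\epsilon_0>0$ and $K$, depending only on $R,S,\delta,r,\mu,\sigma$,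 such that for all $\epsilon^\uparrow,\epsilon^\downarrow\in(0,\epsilon_0)$, with $\gamma^\uparrow=1+\epsilon^\uparrow$, $\gamma^\downarrow=1+\epsilon^\downarrow$ and $\epsilon=\gamma^\uparrow\gamma^\downarrow-1$, data as above exist and, for all such data, all $t\ge0$ and all $(x,y,\phi)$ in the interior of the solvency region with $p\in[p_*,p^*]$, the following holds. If $\hat m>0$, $$C^*_{1+\epsilon^\uparrow,1+\epsilon^\downarrow}(t,x,y,\phi)=C^*_{1,1}(t,x,y,\phi)\Big(1+\tfrac{R(1-S)}{S}\tfrac{\sigma^2}{2\hat m}\Delta^{2/3}(\epsilon^\uparrow+\epsilon^\downarrow)^{2/3}+\tfrac{q_M}{2S}\Big(1-\tfrac12h_3\Big(\tfrac{p-q_M}{\Delta^{1/3}\epsilon^{1/3}}\Big)\Big)(\epsilon^\uparrow+\epsilon^\downarrow)+\tfrac{q_M}{2}(\epsilon^\uparrow-\epsilon^\downarrow)\Big)+E,$$ and if $\hat m=0$, $$C^*_{1+\epsilon^\uparrow,1+\epsilon^\downarrow}(t,x,y,\phi)=(x+y\phi)\,\tfrac{R(1-S)}{S}\tfrac{\sigma^2}{2}\Delta^{2/3}(\epsilon^\uparrow+\epsilon^\downarrow)^{2/3}+E,$$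 where in both cases $|E|\le K\,(x+y\phi)\,\epsilon^{4/3}$. -/

import Mathlib

open Set

namespace EpsteinZin

/-- Parameters of the Black-Scholes-Merton market (interest rate `r`, drift `μ`, volatility `σ`) and
of the Epstein-Zin agent (risk aversion `R`, elasticity of intertemporal complementarity `S`,
discount parameter `δ`). -/
structure Params where
  R : ℝ
  S : ℝ
  δ : ℝ
  r : ℝ
  μ : ℝ
  σ : ℝ

noncomputable section

/-- Market price of risk. -/
def Params.lam (P : Params) : ℝ := (P.μ - P.r) / P.σ

/-- Effective impatience rate. -/
def Params.alpha (P : Params) : ℝ := P.δ - P.r * (1 - P.S)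

/-- Frictionless optimal consumption rate per unit of wealth when the constant fraction `q` of wealth
is held in the risky asset. -/
def Params.m (P : Params) (q : ℝ) : ℝ :=
  P.alpha / P.S - (1 - P.S) / P.S * P.lam * P.σ * q
    + P.R * ((1 - P.S) / P.S) * (P.σ ^ 2 / 2) * q ^ 2

def Params.ell (P : Params) (q : ℝ) : ℝ :=
  P.alpha / P.S - (1 - P.S) / P.S * (P.lam * P.σ - P.σ ^ 2 / 2) * q
    - (1 - P.R) * ((1 - P.S) / P.S) * (P.σ ^ 2 / 2) * q ^ 2

/-- Merton ratio. -/
def Params.qM (P : Params) : ℝ := P.lam / (P.σ * P.R)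

/-- Frictionless optimal consumption rate. -/
def Params.mM (P : Params) : ℝ := P.m P.qM

def Params.Delta (P : Params) : ℝ := 3 * P.qM ^ 2 * (1 - P.qM) ^ 2 / (4 * P.R)

def h3 (v : ℝ) : ℝ := (1 + v) ^ 2 * (2 - v)

/-- The real Möbius transformation `τ_c`, away from its pole. -/
def mobius (c q : ℝ) : ℝ := c * q / (1 + (c - 1) * q)

/-- `n : [a, b] → (0, ∞)` solves the first-order free boundary problem for the round-trip
transaction cost `ξ`, with free boundaries `a = q_*(ξ)` and `b = q^*(ξ)`. -/
structure FreeBoundary (P : Params) (ξ a b : ℝ) (n : ℝ → ℝ) : Prop where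
  loc_mid : 0 < P.qM → P.qM < 1 → 0 < a ∧ a < P.qM ∧ P.qM < b ∧ b < 1
  loc_one : P.qM = 1 → 0 < a ∧ a < b ∧ b = 1
  loc_big : 1 < P.qM → 0 < a ∧ a < P.qM ∧ P.qM < b ∧ b < 2 * P.qM - 1
  loc_neg : P.qM < 0 → 2 * P.qM < a ∧ a < P.qM ∧ P.qM < b ∧ b < 0
  contDiff : ContDiffOn ℝ 1 n (Icc a b)
  pos : ∀ q ∈ Icc a b, 0 < n q
  ne_ell : ∀ q ∈ Icc a b, q ≠ 1 → n q ≠ P.ell q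
  /-- `n` is monotone; it is decreasing exactly when `1 - R` and the Merton ratio have the same
  sign. -/
  anti : 0 < (1 - P.R) * P.qM → AntitoneOn n (Icc a b)
  mono : (1 - P.R) * P.qM < 0 → MonotoneOn n (Icc a b)
  ode : ∀ q ∈ Icc a b, q ≠ 1 →
    derivWithin n (Icc a b) q
      = (1 - P.S) / P.S * (n q / (1 - q)) * ((P.m q - n q) / (P.ell q - n q))
  bd_left : n a = P.m a
  bd_right : n b = P.m b
  deriv_left : derivWithin n (Icc a b) a = 0
  deriv_right : derivWithin n (Icc a b) b = 0
  at_one : 1 ∈ Icc a b → n 1 = P.m 1 ∧ derivWithin n (Icc a b) 1 = deriv P.m 1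
  integral_eq : ξ = Real.exp
    (∫ q in a..b, -(1 / (q * (1 - q))) * ((P.m q - n q) / (P.ell q - n q)))

/-- `κ : [a, b] → (0, ∞)` is the relative shadow price associated with `n`. -/
structure RelShadowPrice (P : Params) (γu γd a b : ℝ) (n κ : ℝ → ℝ) : Prop where
  contDiff : ContDiffOn ℝ 1 κ (Icc a b)
  pos : ∀ q ∈ Icc a b, 0 < κ q
  anti : AntitoneOn κ (Icc a b)
  ode : ∀ q ∈ Icc a b, q ≠ 1 →
    derivWithin κ (Icc a b) q
      = κ q / (q * (1 - q)) * ((P.m q - n q) / (P.ell q - n q))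
  bd_left : κ a = γu
  bd_right : κ b = 1 / γd
  deriv_left : derivWithin κ (Icc a b) a = 0
  deriv_right : derivWithin κ (Icc a b) b = 0

/-- `sf : [p_*, p^*] → [a, b]` expresses the shadow fraction of wealth in terms of the fraction of
wealth invested in the risky asset. -/
structure ShadowFraction (P : Params) (γu γd a b pLow pHigh : ℝ) (n sf : ℝ → ℝ) : Prop where
  contDiff : ContDiffOn ℝ 1 sf (Icc pLow pHigh)
  mapsTo : MapsTo sf (Icc pLow pHigh) (Icc a b)
  mono : MonotoneOn sf (Icc pLow pHigh)
  ode : ∀ p ∈ Icc pLow pHigh, p ≠ 1 →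
    derivWithin sf (Icc pLow pHigh) p = (P.ell (sf p) - n (sf p)) / (P.ell p - P.m p)
  bd_left : sf pLow = a
  bd_right : sf pHigh = b
  deriv_left : derivWithin sf (Icc pLow pHigh) pLow = deriv (mobius γu) pLow
  deriv_right : derivWithin sf (Icc pLow pHigh) pHigh = deriv (mobius (1 / γd)) pHigh
  at_one : 1 ∈ Icc pLow pHigh → sf 1 = 1

/-- The data describing the optimal behaviour: the shadow no-transaction region `[qLow, qHigh]`, the
consumption rate `n` per unit of shadow wealth, the relative shadow price `κ`, and the shadow fraction
of wealth `sf` as a function of the real fraction of wealth. -/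
structure ShadowData where
  qLow : ℝ
  qHigh : ℝ
  n : ℝ → ℝ
  κ : ℝ → ℝ
  sf : ℝ → ℝ

/-- Lower boundary `p_*` of the real no-transaction region. -/
def ShadowData.pLow (D : ShadowData) (γu : ℝ) : ℝ := mobius (1 / γu) D.qLow

/-- Upper boundary `p^*` of the real no-transaction region. -/
def ShadowData.pHigh (D : ShadowData) (γd : ℝ) : ℝ := mobius γd D.qHigh

/-- `D` is the shadow data of the problem with transaction cost parameters `γu`, `γd`. -/
structure ShadowData.Solves (D : ShadowData) (P : Params) (γu γd : ℝ) : Prop where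
  lt : D.pLow γu < D.pHigh γd
  free_boundary : FreeBoundary P (γu * γd) D.qLow D.qHigh D.n
  shadow_price : RelShadowPrice P γu γd D.qLow D.qHigh D.n D.κ
  shadow_fraction :
    ShadowFraction P γu γd D.qLow D.qHigh (D.pLow γu) (D.pHigh γd) D.n D.sf

/-- Interior of the solvency region: `x` is the cash position, `y` the price of the risky asset and
`φ` the number of shares. -/
def Solvent (γu γd x y φ : ℝ) : Prop :=
  0 < y ∧ 0 < x + 1 / γd * max φ 0 * y - γu * max (-φ) 0 * y

/-- Fraction of wealth invested in the risky asset. -/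
def frac (x y φ : ℝ) : ℝ := y * φ / (x + y * φ)

/-- Optimal consumption in feedback form on the no-transaction region: shadow wealth times the
consumption rate per unit of shadow wealth. It does not depend on time. -/
def ShadowData.consumption (D : ShadowData) (_t x y φ : ℝ) : ℝ :=
  (x + φ * y * D.κ (D.sf (frac x y φ))) * D.n (D.sf (frac x y φ))

/-- Optimal consumption without transaction costs. -/
def Params.consumption0 (P : Params) (_t x y φ : ℝ) : ℝ := (x + y * φ) * P.mM

end

end EpsteinZin

/-!
The free boundary problem is rewritten for the scaled excess `g = (n - m) / gap`, where
`gap * q * (1 - q) = ell - m`, and for the decrease `I` of `log κ` on `[q_*, q]`. With `G = I'` it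
reads `g' = -2 R (q - q_M) - (2 / σ²) n q G` and `q (1 - q) (q (1 - q) - g) G = g`, where `g`
vanishes at both ends and `I` increases from `0` to `log ξ`. Hence `g` is a parabola up to an error
`O(I)`, so that the no-transaction region has width of order `ε ^ (1 / 3)`; integrating `G` gives
the cubic `h₃` and the width coefficient `Δ ^ (1 / 3)`, and one further iteration gives `n` up to
`O(ε ^ (4 / 3))`. To make the constants uniform, a quantity is said to be of order `k` if it is
`O(ε ^ (k / 3))` along the filter of small costs on the type of all solutions with a marked point.

Conversely, the second equation can be solved for `G` near `(q_M, 0)`, so that the first becomes an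
ordinary differential equation for `g`. The solution with a small value at `q_M` is positive on an
interval around `q_M`, at whose ends it vanishes; the integral of `G` over that interval depends
continuously on the value at `q_M`, and the intermediate value theorem yields every small `log ξ`.
-/

namespace EpsteinZin

open Filter Topology Asymptotics

/-! ### Functions with one-sided derivatives on a compact interval -/

theorem monotoneOn_Icc_of_hasDerivWithinAt {f f' : ℝ → ℝ} {a b : ℝ}
    (hf : ∀ x ∈ Icc a b, HasDerivWithinAt f (f' x) (Icc a b) x)
    (h : ∀ x ∈ Icc a b, 0 ≤ f' x) : MonotoneOn f (Icc a b) :=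
  monotoneOn_of_hasDerivWithinAt_nonneg (convex_Icc a b)
    (fun x hx => (hf x hx).continuousWithinAt)
    (fun x hx => (hf x (interior_subset hx)).mono interior_subset)
    fun x hx => h x (interior_subset hx)

theorem antitoneOn_Icc_of_hasDerivWithinAt {f f' : ℝ → ℝ} {a b : ℝ}
    (hf : ∀ x ∈ Icc a b, HasDerivWithinAt f (f' x) (Icc a b) x)
    (h : ∀ x ∈ Icc a b, f' x ≤ 0) : AntitoneOn f (Icc a b) :=
  antitoneOn_of_hasDerivWithinAt_nonpos (convex_Icc a b)
    (fun x hx => (hf x hx).continuousWithinAt)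
    (fun x hx => (hf x (interior_subset hx)).mono interior_subset)
    fun x hx => h x (interior_subset hx)

theorem strictMonoOn_Icc_of_hasDerivWithinAt {f f' : ℝ → ℝ} {a b : ℝ}
    (hf : ∀ x ∈ Icc a b, HasDerivWithinAt f (f' x) (Icc a b) x)
    (h : ∀ x ∈ Icc a b, 0 < f' x) : StrictMonoOn f (Icc a b) :=
  strictMonoOn_of_hasDerivWithinAt_pos (convex_Icc a b)
    (fun x hx => (hf x hx).continuousWithinAt)
    (fun x hx => (hf x (interior_subset hx)).mono interior_subset)
    fun x hx => h x (interior_subset hx)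

theorem sub_le_sub_of_hasDerivWithinAt_le {f f' g g' : ℝ → ℝ} {a b : ℝ}
    (hf : ∀ x ∈ Icc a b, HasDerivWithinAt f (f' x) (Icc a b) x)
    (hg : ∀ x ∈ Icc a b, HasDerivWithinAt g (g' x) (Icc a b) x)
    (h : ∀ x ∈ Icc a b, f' x ≤ g' x) {x : ℝ} (hx : x ∈ Icc a b) : f x - f a ≤ g x - g a := by
  have hmono := monotoneOn_Icc_of_hasDerivWithinAt (fun x hx => (hg x hx).sub (hf x hx))
    fun x hx => sub_nonneg.2 (h x hx)
  have := hmono (left_mem_Icc.2 (hx.1.trans hx.2)) hx hx.1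
  simp only [Pi.sub_apply] at this
  linarith

theorem abs_sub_le_of_abs_hasDerivWithinAt_le {f f' g g' : ℝ → ℝ} {a b : ℝ}
    (hf : ∀ x ∈ Icc a b, HasDerivWithinAt f (f' x) (Icc a b) x)
    (hg : ∀ x ∈ Icc a b, HasDerivWithinAt g (g' x) (Icc a b) x)
    (h : ∀ x ∈ Icc a b, |f' x| ≤ g' x) {x : ℝ} (hx : x ∈ Icc a b) :
    |f x - f a| ≤ g x - g a := by
  have hneg := sub_le_sub_of_hasDerivWithinAt_le (fun x hx => (hf x hx).neg) hg
    (fun x hx => (neg_le_abs _).trans (h x hx)) hx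
  refine abs_le'.2 ⟨sub_le_sub_of_hasDerivWithinAt_le hf hg
    (fun x hx => (le_abs_self _).trans (h x hx)) hx, ?_⟩
  simp only [Pi.neg_apply] at hneg
  linarith

theorem contDiffOn_one_Icc_of_hasDerivWithinAt {f f' : ℝ → ℝ} {a b : ℝ} (hab : a < b)
    (hf : ∀ x ∈ Icc a b, HasDerivWithinAt f (f' x) (Icc a b) x)
    (hc : ContinuousOn f' (Icc a b)) : ContDiffOn ℝ 1 f (Icc a b) := by
  have hu := uniqueDiffOn_Icc hab
  exact (contDiffOn_one_iff_derivWithin hu).2 ⟨fun x hx => (hf x hx).differentiableWithinAt,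
    hc.congr fun x hx => (hf x hx).derivWithin (hu x hx)⟩

theorem hasDerivWithinAt_integral_Icc {f : ℝ → ℝ} {a b c : ℝ} (hf : ContinuousOn f (Icc a b))
    (hc : c ∈ Icc a b) {x : ℝ} (hx : x ∈ Icc a b) :
    HasDerivWithinAt (fun x => ∫ t in c..x, f t) (f x) (Icc a b) x := by
  have : Fact (x ∈ Icc a b) := ⟨hx⟩
  exact intervalIntegral.integral_hasDerivWithinAt_right
    (hf.mono (ordConnected_Icc.uIcc_subset hc hx)).intervalIntegrable
    ⟨Icc a b, self_mem_nhdsWithin, hf.aestronglyMeasurable measurableSet_Icc⟩ (hf x hx)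

theorem hasDerivWithinAt_of_rightInvOn {f g : ℝ → ℝ} {f' y : ℝ} {s t : Set ℝ}
    (hf : HasDerivWithinAt f f' t (g y)) (hf' : f' ≠ 0) (hg : ContinuousWithinAt g s y)
    (hmaps : MapsTo g s t) (hy : y ∈ s) (hinv : RightInvOn g f s) :
    HasDerivWithinAt g f'⁻¹ s y := by
  have hf : HasFDerivWithinAt f
      (ContinuousLinearEquiv.unitsEquivAut ℝ (Units.mk0 f' hf') : ℝ →L[ℝ] ℝ) t (g y) :=
    hf.hasFDerivWithinAt.congr_fderiv (by ext; simp)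
  refine (hf.of_local_left_inverse (hg.tendsto_nhdsWithin hmaps) hy
    (eventually_mem_nhdsWithin.mono fun z hz => hinv hz)).hasDerivWithinAt.congr_deriv ?_
  simp [ContinuousLinearEquiv.unitsEquivAut_apply_symm]

theorem exists_continuousOn_inverse_Icc {f : ℝ → ℝ} {a b : ℝ} (hab : a ≤ b)
    (hf : ContinuousOn f (Icc a b)) (hmono : StrictMonoOn f (Icc a b)) :
    ∃ s : ℝ → ℝ, MapsTo s (Icc (f a) (f b)) (Icc a b) ∧ RightInvOn s f (Icc (f a) (f b)) ∧
      LeftInvOn s f (Icc a b) ∧ ContinuousOn s (Icc (f a) (f b)) := by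
  have himage : f '' Icc a b = Icc (f a) (f b) := by
    refine (image_subset_iff.2 fun x hx => ?_).antisymm (intermediate_value_Icc hab hf)
    exact ⟨hmono.monotoneOn (left_mem_Icc.2 hab) hx hx.1,
      hmono.monotoneOn hx (right_mem_Icc.2 hab) hx.2⟩
  have hsurj : SurjOn f (Icc a b) (Icc (f a) (f b)) := himage.ge
  have hleft : LeftInvOn (Function.invFunOn f (Icc a b)) f (Icc a b) :=
    hmono.injOn.leftInvOn_invFunOn
  refine ⟨Function.invFunOn f (Icc a b), hsurj.mapsTo_invFunOn, hsurj.rightInvOn_invFunOn,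
    hleft, ?_⟩
  have : (f '' Icc a b).OrdConnected := himage ▸ ordConnected_Icc
  let e := hmono.orderIso f (Icc a b)
  rw [← himage, continuousOn_iff_continuous_domRestrict]
  refine (continuous_subtype_val.comp e.symm.continuous).congr fun y => ?_
  obtain ⟨x, rfl⟩ := e.surjective y
  exact (congrArg Subtype.val (e.symm_apply_apply x)).trans (hleft x.2).symm

theorem exists_contDiffOn_inverse_Icc {f f' : ℝ → ℝ} {a b : ℝ} (hab : a < b)
    (hf : ∀ x ∈ Icc a b, HasDerivWithinAt f (f' x) (Icc a b) x) (hf' : ContinuousOn f' (Icc a b))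
    (hpos : ∀ x ∈ Icc a b, 0 < f' x) :
    ∃ s : ℝ → ℝ, MapsTo s (Icc (f a) (f b)) (Icc a b) ∧ RightInvOn s f (Icc (f a) (f b)) ∧
      LeftInvOn s f (Icc a b) ∧ MonotoneOn s (Icc (f a) (f b)) ∧
      ContDiffOn ℝ 1 s (Icc (f a) (f b)) ∧
      ∀ y ∈ Icc (f a) (f b), HasDerivWithinAt s (f' (s y))⁻¹ (Icc (f a) (f b)) y := by
  have hmono := strictMonoOn_Icc_of_hasDerivWithinAt hf hpos
  obtain ⟨s, hmaps, hright, hleft, hcont⟩ := exists_continuousOn_inverse_Icc hab.le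
    (fun x hx => (hf x hx).continuousWithinAt) hmono
  have hderiv : ∀ y ∈ Icc (f a) (f b), HasDerivWithinAt s (f' (s y))⁻¹ (Icc (f a) (f b)) y :=
    fun y hy => hasDerivWithinAt_of_rightInvOn (hf _ (hmaps hy)) (hpos _ (hmaps hy)).ne'
      (hcont y hy) hmaps hy hright
  refine ⟨s, hmaps, hright, hleft, fun y hy z hz hyz => ?_,
    contDiffOn_one_Icc_of_hasDerivWithinAt
      (hmono (left_mem_Icc.2 hab.le) (right_mem_Icc.2 hab.le) hab) hderiv
      ((hf'.comp hcont hmaps).inv₀ fun y hy => (hpos _ (hmaps hy)).ne'), hderiv⟩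
  rwa [← hmono.le_iff_le (hmaps hy) (hmaps hz), hright hy, hright hz]

theorem Icc_subset_closure_diff_singleton {a b : ℝ} (h : a < b) (c : ℝ) :
    Icc a b ⊆ closure (Icc a b \ {c}) := by
  rw [← closure_Ioo h.ne]
  refine closure_minimal (((dense_compl_singleton c).open_subset_closure_inter isOpen_Ioo).trans
    (closure_mono fun x hx => ⟨?_, hx.2⟩)) isClosed_closure
  exact subset_closure hx.1

theorem pos_of_ne_zero_of_pos {f : ℝ → ℝ} {s : Set ℝ} (hs : s.OrdConnected)
    (hf : ContinuousOn f s) (h0 : ∀ x ∈ s, f x ≠ 0) {x y : ℝ} (hx : x ∈ s) (hy : y ∈ s)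
    (h : 0 < f x) : 0 < f y := by
  by_contra! hlt
  obtain ⟨z, hz, hz0⟩ := hs.isPreconnected.intermediate_value hy hx hf ⟨hlt, h.le⟩
  exact h0 z hz hz0

/-! ### Orders of magnitude -/

/-- A type of configurations with a positive size. Estimates that are uniform in all configurations
of small size are expressed along the filter `smallSize`, so that they can be combined by the
calculus of `O` symbols. -/
class Sized (X : Type*) where
  size : X → ℝ
  size_pos : ∀ x, 0 < size x

open Sized

section Order

variable {X Y : Type*} [Sized X] [Sized Y] {n k : ℕ} {f g : X → ℝ}

variable (X) in
/-- The filter of the sets containing all configurations of sufficiently small size. -/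
def smallSize : Filter X := comap size (𝓝 0)

/-- `f` is of the order of the `n`-th power of the size, uniformly over all small
configurations. -/
def IsOrder (n : ℕ) (f : X → ℝ) : Prop := f =O[smallSize X] fun x => size x ^ n

theorem tendsto_size : Tendsto (size : X → ℝ) (smallSize X) (𝓝 0) := tendsto_comap

theorem eventually_smallSize {p : X → Prop} :
    (∀ᶠ x in smallSize X, p x) ↔ ∃ δ > 0, ∀ x, size x < δ → p x := by
  rw [smallSize, eventually_comap, Metric.eventually_nhds_iff]
  constructor
  · rintro ⟨δ, hδ, H⟩
    exact ⟨δ, hδ, fun x hx => H (by simpa [abs_of_pos (size_pos x)] using hx) x rfl⟩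
  · rintro ⟨δ, hδ, H⟩
    refine ⟨δ, hδ, fun _ hy x hx => H x ?_⟩
    simpa [← hx, abs_of_pos (size_pos x)] using hy

namespace IsOrder

theorem add (hf : IsOrder n f) (hg : IsOrder n g) : IsOrder n fun x => f x + g x :=
  IsBigO.add hf hg

theorem sub (hf : IsOrder n f) (hg : IsOrder n g) : IsOrder n fun x => f x - g x :=
  IsBigO.sub hf hg

theorem mul (hf : IsOrder n f) (hg : IsOrder k g) : IsOrder (n + k) fun x => f x * g x := by
  simpa only [IsOrder, pow_add] using IsBigO.mul hf hg

theorem pow (hf : IsOrder n f) (k : ℕ) : IsOrder (n * k) fun x => f x ^ k := by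
  simpa only [IsOrder, pow_mul] using IsBigO.pow hf k

theorem const_mul (c : ℝ) (hf : IsOrder n f) : IsOrder n fun x => c * f x :=
  IsBigO.const_mul_left hf c

theorem const (c : ℝ) : IsOrder (X := X) 0 fun _ => c := by
  simpa only [IsOrder, pow_zero] using isBigO_const_const c one_ne_zero _

theorem size_pow (n : ℕ) : IsOrder (X := X) n fun x => size x ^ n := isBigO_refl _ _

theorem size_self : IsOrder (X := X) 1 size := by simpa only [pow_one] using size_pow (X := X) 1

theorem of_eq (hf : IsOrder n f) (h : ∀ x, g x = f x) : IsOrder n g := by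
  rwa [show g = f from funext h]

theorem of_abs_le (hg : IsOrder n g) (C : ℝ) (h : ∀ᶠ x in smallSize X, |f x| ≤ C * |g x|) :
    IsOrder n f :=
  IsBigO.trans (.of_bound C h) hg

theorem mono (hf : IsOrder n f) (hk : k ≤ n := by norm_num) : IsOrder k f :=
  IsBigO.trans hf <| by
    obtain rfl | hlt := hk.eq_or_lt
    · exact isBigO_refl _ _
    · exact (isLittleO_pow_pow hlt).isBigO.comp_tendsto tendsto_size

theorem of_pow (hf : IsOrder (n * k) fun x => f x ^ k) (hk : k ≠ 0 := by norm_num) :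
    IsOrder n f :=
  IsBigO.of_pow (n := k) (g := fun x => size x ^ n) hk
    (by simpa only [IsOrder, Pi.pow_def, pow_mul] using hf)

theorem tendsto_zero (hf : IsOrder n f) (hn : n ≠ 0 := by norm_num) :
    Tendsto f (smallSize X) (𝓝 0) :=
  IsBigO.trans_tendsto hf (by simpa only [zero_pow hn] using tendsto_size.pow n)

theorem comp (hf : IsOrder n f) (e : Y → X) (he : ∀ y, size (e y) = size y) :
    IsOrder n fun y => f (e y) := by
  have hcomp : (size : X → ℝ) ∘ e = size := funext he
  have htendsto : Tendsto e (smallSize Y) (smallSize X) := by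
    rw [smallSize, smallSize, tendsto_comap_iff, hcomp]
    exact tendsto_comap
  simpa only [IsOrder, Function.comp_def, he] using IsBigO.comp_tendsto hf htendsto

theorem exists_bound (hf : IsOrder n f) :
    ∃ C ≥ 0, ∃ δ > 0, ∀ x, size x < δ → |f x| ≤ C * size x ^ n := by
  obtain ⟨C, hC, hbound⟩ := IsBigO.exists_nonneg hf
  obtain ⟨δ, hδ, hbound⟩ := eventually_smallSize.1 hbound.bound
  refine ⟨C, hC, δ, hδ, fun x hx => ?_⟩
  simpa [abs_of_pos (size_pos x)] using hbound x hx

theorem cancel (hfg : IsOrder (n + k) fun x => f x * g x)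
    (hg : (fun x => size x ^ k) =O[smallSize X] g) : IsOrder n f := by
  have h := (((isBigO_refl f _).mul hg).trans hfg).mul
    (isBigO_refl (fun x => (size x ^ k)⁻¹) (smallSize X))
  have hne : ∀ x : X, size x ^ k ≠ 0 := fun x => (pow_pos (size_pos x) k).ne'
  simpa only [IsOrder, pow_add, mul_inv_cancel_right₀ (hne _)] using h

theorem cancel_of_tendsto {c : ℝ} (hfg : IsOrder n fun x => f x * g x)
    (hg : Tendsto g (smallSize X) (𝓝 c)) (hc : c ≠ 0) : IsOrder n f := by
  refine cancel (k := 0) hfg ?_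
  simp only [pow_zero]
  exact (isBigO_const_const 1 hc _).trans ((isEquivalent_const_iff_tendsto hc).2 hg).isBigO_symm

theorem div_one_add_sub (hf : IsOrder k f) (hg : IsOrder n g) (hn : n ≠ 0 := by norm_num) :
    IsOrder (k + n) fun x => f x / (1 + g x) - f x := by
  have hlim : Tendsto (fun x => 1 + g x) (smallSize X) (𝓝 1) := by
    simpa using (hg.tendsto_zero hn).const_add 1
  refine .cancel_of_tendsto ((hf.mul hg).of_abs_le 1 ?_) hlim one_ne_zero
  filter_upwards [hlim.eventually_ne one_ne_zero] with x hx
  rw [sub_mul, div_mul_cancel₀ _ hx, mul_one_add, sub_add_cancel_left, abs_neg, one_mul]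

/-- The mean value inequality. The pointwise bound on the derivative is obtained from an estimate
`g` at configurations whose size agrees with that of `x`. -/
theorem image_sub_isBigO {F F' : X → ℝ → ℝ} {a b : X → ℝ} (hg : IsOrder n g)
    (hab : ∀ x, a x ≤ b x)
    (hF : ∀ x, ∀ t ∈ Icc (a x) (b x), HasDerivWithinAt (F x) (F' x t) (Icc (a x) (b x)) t)
    (hF' : ∀ x, ∀ t ∈ Icc (a x) (b x), ∃ y, size y = size x ∧ g y = F' x t) :
    (fun x => F x (b x) - F x (a x)) =O[smallSize X] fun x => size x ^ n * (b x - a x) := by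
  obtain ⟨C, -, δ, hδ, hbound⟩ := hg.exists_bound
  refine .of_bound C (eventually_smallSize.2 ⟨δ, hδ, fun x hx => ?_⟩)
  have hderiv : ∀ t ∈ Icc (a x) (b x), ‖F' x t‖ ≤ C * size x ^ n := fun t ht => by
    obtain ⟨y, hy, hyt⟩ := hF' x t ht
    rw [← hyt, ← hy]
    exact hbound y (hy.trans_lt hx)
  have hmvt := (convex_Icc (a x) (b x)).norm_image_sub_le_of_norm_hasDerivWithin_le (hF x) hderiv
    (left_mem_Icc.2 (hab x)) (right_mem_Icc.2 (hab x))
  rwa [norm_mul, norm_pow, Real.norm_of_nonneg (size_pos x).le, ← mul_assoc]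

theorem image_sub {F F' : X → ℝ → ℝ} {a b : X → ℝ} (hg : IsOrder n g)
    (hwidth : IsOrder k fun x => b x - a x) (hab : ∀ x, a x ≤ b x)
    (hF : ∀ x, ∀ t ∈ Icc (a x) (b x), HasDerivWithinAt (F x) (F' x t) (Icc (a x) (b x)) t)
    (hF' : ∀ x, ∀ t ∈ Icc (a x) (b x), ∃ y, size y = size x ∧ g y = F' x t) :
    IsOrder (n + k) fun x => F x (b x) - F x (a x) :=
  (hg.image_sub_isBigO hab hF hF').trans ((size_pow n).mul hwidth)

end IsOrder

end Order

/-! ### The polynomials of the expansion -/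

/-- The primitive of `s ↦ u ^ 2 - s ^ 2` vanishing at `-u`. -/
noncomputable def cubic (u s : ℝ) : ℝ := (u + s) ^ 2 * (2 * u - s) / 3

/-- The primitive of `cubic u` vanishing at `-u`. -/
noncomputable def quartic (u s : ℝ) : ℝ := (u + s) ^ 3 * (3 * u - s) / 12

theorem hasDerivAt_cubic_sub (u c s : ℝ) :
    HasDerivAt (fun s => cubic u (s - c)) (u ^ 2 - (s - c) ^ 2) s := by
  have h := (hasDerivAt_id s).sub_const c
  refine ((((h.const_add u).pow 2).mul (h.const_sub (2 * u))).div_const 3).congr_deriv ?_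
  simp only [id, Pi.pow_apply, Nat.cast_ofNat]
  ring

theorem hasDerivAt_quartic_sub (u c s : ℝ) :
    HasDerivAt (fun s => quartic u (s - c)) (cubic u (s - c)) s := by
  have h := (hasDerivAt_id s).sub_const c
  refine ((((h.const_add u).pow 3).mul (h.const_sub (3 * u))).div_const 12).congr_deriv ?_
  simp only [cubic, id, Pi.pow_apply, Nat.cast_ofNat]
  ring

theorem hasDerivAt_sq_sub_sq_sub (u c s : ℝ) :
    HasDerivAt (fun s => u ^ 2 - (s - c) ^ 2) (-(2 * (s - c))) s := by
  refine ((((hasDerivAt_id s).sub_const c).pow 2).const_sub (u ^ 2)).congr_deriv ?_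
  simp

theorem cubic_neg_self (u : ℝ) : cubic u (-u) = 0 := by simp [cubic]

theorem quartic_neg_self (u : ℝ) : quartic u (-u) = 0 := by simp [quartic]

/-! ### The reduced free boundary problem -/

namespace Params

/-- The coefficient of `q * (1 - q)` in `ell q - m q`. -/
noncomputable def gap (P : Params) : ℝ := (1 - P.S) / P.S * (P.σ ^ 2 / 2)

/-- The standing assumptions on the parameters. -/
structure Regular (P : Params) : Prop where
  σ_pos : 0 < P.σ
  R_pos : 0 < P.R
  S_pos : 0 < P.S
  R_ne_one : P.R ≠ 1
  gap_ne : P.gap ≠ 0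
  qM_ne_zero : P.qM ≠ 0
  qM_ne_one : P.qM ≠ 1

/-- The consumption rate expressed through the scaled excess `g = (n - m) / gap`. -/
noncomputable def rate (P : Params) (g : ℝ → ℝ) (q : ℝ) : ℝ :=
  P.mM + P.gap * (P.R * (q - P.qM) ^ 2 + g q)

/-- An upper bound for `|q|` and `|q - qM|` on the no-transaction region. -/
noncomputable def fracBound (P : Params) : ℝ := 3 * |P.qM| + 1

/-- An upper bound for the consumption rate. -/
noncomputable def rateBound (P : Params) : ℝ := |P.mM| + |P.gap| * P.R * P.fracBound ^ 2

/-- An upper bound for the deviation of the scaled excess from a parabola, relative to the decrease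
of the logarithm of the relative shadow price. -/
noncomputable def defectBound (P : Params) : ℝ := 2 / P.σ ^ 2 * (P.rateBound * P.fracBound)

/-- An upper bound for the factor between the scaled excess and the logarithmic derivative of the
relative shadow price. -/
noncomputable def weightBound (P : Params) : ℝ :=
  P.fracBound * (1 + P.fracBound) *
    (P.fracBound * (1 + P.fracBound) + (P.R * P.fracBound ^ 2 + P.defectBound))

theorem ell_sub_m (P : Params) (q : ℝ) : P.ell q - P.m q = P.gap * (q * (1 - q)) := by
  simp only [ell, m, gap]
  ring

theorem m_eq {P : Params} (hσ : P.σ ≠ 0) (hR : P.R ≠ 0) (q : ℝ) :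
    P.m q = P.mM + P.gap * P.R * (q - P.qM) ^ 2 := by
  have hlam : P.lam = P.σ * P.R * P.qM := by
    simp only [qM]
    field_simp
  simp only [mM, m, gap, hlam]
  ring

theorem fracBound_pos (P : Params) : 0 < P.fracBound := by
  unfold fracBound
  positivity

theorem rateBound_nonneg {P : Params} (hR : 0 < P.R) : 0 ≤ P.rateBound := by
  unfold rateBound
  positivity

theorem defectBound_nonneg {P : Params} (hR : 0 < P.R) : 0 ≤ P.defectBound :=
  mul_nonneg (by positivity) (mul_nonneg (rateBound_nonneg hR) P.fracBound_pos.le)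

end Params

/-- The free boundary problem in terms of the scaled excess `g = (n - m) / gap` and of the decrease
`I` of the logarithm of the relative shadow price, whose derivative is `G`. The total decrease `L`
is the logarithm of the round-trip cost. -/
structure ReducedSolution (P : Params) (L a b : ℝ) (g I G : ℝ → ℝ) : Prop where
  left_lt : a < P.qM
  lt_right : P.qM < b
  abs_q_le : ∀ q ∈ Icc a b, |q| ≤ 2 * |P.qM| + 1
  g_left : g a = 0
  g_right : g b = 0
  I_left : I a = 0
  I_right : I b = L
  deriv_I : ∀ q ∈ Icc a b, HasDerivWithinAt I (G q) (Icc a b) q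
  deriv_g : ∀ q ∈ Icc a b, HasDerivWithinAt g
    (-(2 * P.R * (q - P.qM)) - 2 / P.σ ^ 2 * (P.rate g q * q * G q)) (Icc a b) q
  g_nonneg : ∀ q ∈ Icc a b, 0 ≤ g q
  G_nonneg : ∀ q ∈ Icc a b, 0 ≤ G q
  mul_G : ∀ q ∈ Icc a b, q * (1 - q) * (q * (1 - q) - g q) * G q = g q
  rate_le : ∀ q ∈ Icc a b, |P.rate g q| ≤ P.rateBound

namespace ReducedSolution

variable {P : Params} {L a b : ℝ} {g I G : ℝ → ℝ}

theorem lt (h : ReducedSolution P L a b g I G) : a < b := h.left_lt.trans h.lt_right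

theorem left_mem (h : ReducedSolution P L a b g I G) : a ∈ Icc a b := left_mem_Icc.2 h.lt.le

theorem right_mem (h : ReducedSolution P L a b g I G) : b ∈ Icc a b := right_mem_Icc.2 h.lt.le

theorem I_mono (h : ReducedSolution P L a b g I G) : MonotoneOn I (Icc a b) :=
  monotoneOn_Icc_of_hasDerivWithinAt h.deriv_I h.G_nonneg

theorem I_nonneg (h : ReducedSolution P L a b g I G) {q : ℝ} (hq : q ∈ Icc a b) : 0 ≤ I q :=
  h.I_left.ge.trans (h.I_mono h.left_mem hq hq.1)

theorem I_le (h : ReducedSolution P L a b g I G) {q : ℝ} (hq : q ∈ Icc a b) : I q ≤ L :=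
  (h.I_mono hq h.right_mem hq.2).trans h.I_right.le

theorem abs_le_fracBound (h : ReducedSolution P L a b g I G) {q : ℝ} (hq : q ∈ Icc a b) :
    |q| ≤ P.fracBound := by
  unfold Params.fracBound
  linarith [h.abs_q_le q hq, abs_nonneg P.qM]

theorem abs_sub_le_fracBound (h : ReducedSolution P L a b g I G) {q : ℝ} (hq : q ∈ Icc a b) :
    |q - P.qM| ≤ P.fracBound := by
  unfold Params.fracBound
  linarith [h.abs_q_le q hq, abs_sub q P.qM]

theorem abs_g_sub_le (hR : 0 < P.R) (h : ReducedSolution P L a b g I G) {q : ℝ}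
    (hq : q ∈ Icc a b) :
    |g q - P.R * ((P.qM - a) ^ 2 - (q - P.qM) ^ 2)| ≤ P.defectBound * I q := by
  have hderiv : ∀ q ∈ Icc a b,
      HasDerivWithinAt (fun q => g q - P.R * ((P.qM - a) ^ 2 - (q - P.qM) ^ 2))
        (-(2 / P.σ ^ 2 * (P.rate g q * q * G q))) (Icc a b) q := fun q hq =>
    ((h.deriv_g q hq).sub
      ((hasDerivAt_sq_sub_sq_sub _ _ q).const_mul P.R).hasDerivWithinAt).congr_deriv (by ring)
  have hbound : ∀ q ∈ Icc a b,
      |-(2 / P.σ ^ 2 * (P.rate g q * q * G q))| ≤ P.defectBound * G q := fun q hq => by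
    have hrate := h.rate_le q hq
    have hfrac := h.abs_le_fracBound hq
    have hG := h.G_nonneg q hq
    have hB := Params.rateBound_nonneg hR
    rw [abs_neg, abs_mul, abs_mul, abs_mul, abs_of_nonneg hG,
      abs_of_nonneg (by positivity : 0 ≤ 2 / P.σ ^ 2), Params.defectBound, mul_assoc (2 / P.σ ^ 2)]
    gcongr
  have hvar := abs_sub_le_of_abs_hasDerivWithinAt_le hderiv
    (fun q hq => (h.deriv_I q hq).const_mul P.defectBound) hbound hq
  simpa only [h.g_left, h.I_left, ← neg_sub P.qM a, neg_sq, sub_self, mul_zero, sub_zero] using hvar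

theorem abs_g_sub_le_mul (hR : 0 < P.R) (h : ReducedSolution P L a b g I G) {q : ℝ}
    (hq : q ∈ Icc a b) :
    |g q - P.R * ((P.qM - a) ^ 2 - (q - P.qM) ^ 2)| ≤ P.defectBound * L :=
  (h.abs_g_sub_le hR hq).trans
    (mul_le_mul_of_nonneg_left (h.I_le hq) (Params.defectBound_nonneg hR))

theorem g_le (hR : 0 < P.R) (h : ReducedSolution P L a b g I G) (hL : L ≤ 1) {q : ℝ}
    (hq : q ∈ Icc a b) : g q ≤ P.R * P.fracBound ^ 2 + P.defectBound := by
  have hdev := (abs_le.1 (h.abs_g_sub_le_mul hR hq)).2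
  have hsq : (P.qM - a) ^ 2 ≤ P.fracBound ^ 2 :=
    sq_le_sq' (by linarith [h.left_lt, P.fracBound_pos])
      (by linarith [(abs_le.1 (h.abs_sub_le_fracBound h.left_mem)).1])
  nlinarith [mul_le_mul_of_nonneg_left hL (Params.defectBound_nonneg hR),
    mul_le_mul_of_nonneg_left hsq hR.le, mul_nonneg hR.le (sq_nonneg (q - P.qM))]

theorem g_le_mul_G (hR : 0 < P.R) (h : ReducedSolution P L a b g I G) (hL : L ≤ 1) {q : ℝ}
    (hq : q ∈ Icc a b) : g q ≤ P.weightBound * G q := by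
  have hB := P.fracBound_pos
  have hweight : |q * (1 - q)| ≤ P.fracBound * (1 + P.fracBound) := by
    have := (abs_sub 1 q).trans (add_le_add abs_one.le (h.abs_le_fracBound hq))
    rw [abs_mul]
    gcongr
    exact h.abs_le_fracBound hq
  have hdiff : |q * (1 - q) - g q| ≤
      P.fracBound * (1 + P.fracBound) + (P.R * P.fracBound ^ 2 + P.defectBound) :=
    (abs_sub _ _).trans (add_le_add hweight
      ((abs_of_nonneg (h.g_nonneg q hq)).le.trans (h.g_le hR hL hq)))
  rw [← h.mul_G q hq]
  refine mul_le_mul_of_nonneg_right ((le_abs_self _).trans ?_) (h.G_nonneg q hq)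
  rw [abs_mul]
  exact mul_le_mul hweight hdiff (abs_nonneg _) (by positivity)

theorem mul_cubic_le (hR : 0 < P.R) (h : ReducedSolution P L a b g I G) (hL : L ≤ 1) :
    P.R * cubic (P.qM - a) (b - P.qM) ≤ P.weightBound * L + P.defectBound * L * (b - a) := by
  have hle : ∀ q ∈ Icc a b, P.R * ((P.qM - a) ^ 2 - (q - P.qM) ^ 2) ≤
      P.weightBound * G q + P.defectBound * L * 1 := fun q hq => by
    linarith [(abs_le.1 (h.abs_g_sub_le_mul hR hq)).1, h.g_le_mul_G hR hL hq]
  have hvar := sub_le_sub_of_hasDerivWithinAt_le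
    (fun q _ => ((hasDerivAt_cubic_sub (P.qM - a) P.qM q).const_mul P.R).hasDerivWithinAt)
    (fun q hq => ((h.deriv_I q hq).const_mul P.weightBound).add
      ((hasDerivAt_id q).const_mul (P.defectBound * L)).hasDerivWithinAt) hle h.right_mem
  simp only [Pi.add_apply, h.I_left, h.I_right, ← neg_sub P.qM a, cubic_neg_self, id] at hvar
  linarith

theorem width_cube_le (hR : 0 < P.R) (h : ReducedSolution P L a b g I G) (hL : L ≤ 1) :
    (P.qM - a) ^ 3 + (b - P.qM) ^ 3 ≤
      (P.weightBound + 3 * P.defectBound * P.fracBound) / (2 / 3 * P.R) * L := by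
  have hDL : 0 ≤ P.defectBound * L := (abs_nonneg _).trans (h.abs_g_sub_le_mul hR h.right_mem)
  have hleft := (abs_le.1 (h.abs_sub_le_fracBound h.left_mem)).1
  have hright := (abs_le.1 (h.abs_sub_le_fracBound h.right_mem)).2
  have hwidths : P.R * ((b - P.qM) ^ 2 - (P.qM - a) ^ 2) ≤ P.defectBound * L := by
    have := (abs_le.1 (h.abs_g_sub_le_mul hR h.right_mem)).2
    rw [h.g_right] at this
    linarith
  have hv : P.R * ((b - P.qM) ^ 2 - (P.qM - a) ^ 2) * (b - P.qM) ≤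
      P.defectBound * L * P.fracBound :=
    mul_le_mul hwidths hright (sub_nonneg.2 h.lt_right.le) hDL
  have hba : P.defectBound * L * (b - a) ≤ P.defectBound * L * (2 * P.fracBound) :=
    mul_le_mul_of_nonneg_left (by linarith) hDL
  have hcubic := h.mul_cubic_le hR hL
  rw [div_mul_eq_mul_div, le_div_iff₀ (by positivity)]
  simp only [cubic] at hcubic
  linarith

end ReducedSolution

/-! ### Uniform expansions of the reduced solutions -/

namespace Params

/-- The value at the Merton ratio of the weight `(q * (1 - q)) ^ 2`. -/
noncomputable def weightM (P : Params) : ℝ := (P.qM * (1 - P.qM)) ^ 2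

/-- The derivative at the Merton ratio of the weight `(q * (1 - q)) ^ 2`. -/
noncomputable def weightSlope (P : Params) : ℝ := 2 * (P.qM * (1 - P.qM)) * (1 - 2 * P.qM)

/-- The coefficient of the decrease of the logarithm of the relative shadow price in the expansion
of the scaled excess. -/
noncomputable def excessSlope (P : Params) : ℝ := 2 / P.σ ^ 2 * P.mM * P.qM

/-- The leading coefficient of the half-width of the no-transaction region. -/
noncomputable def widthCoeff (P : Params) : ℝ := P.Delta ^ (1 / 3 : ℝ)

theorem Delta_eq (P : Params) : P.Delta = 3 * P.weightM / (4 * P.R) := by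
  simp only [Delta, weightM]
  ring

namespace Regular

variable {P : Params}

theorem weightM_pos (hP : P.Regular) : 0 < P.weightM :=
  pow_two_pos_of_ne_zero (mul_ne_zero hP.qM_ne_zero (sub_ne_zero.2 hP.qM_ne_one.symm))

theorem Delta_pos (hP : P.Regular) : 0 < P.Delta := by
  have := hP.R_pos
  have := hP.weightM_pos
  rw [Delta_eq]
  positivity

theorem widthCoeff_pos (hP : P.Regular) : 0 < P.widthCoeff :=
  Real.rpow_pos_of_pos hP.Delta_pos _

theorem widthCoeff_cube (hP : P.Regular) : P.widthCoeff ^ 3 = P.Delta := by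
  rw [widthCoeff, ← Real.rpow_natCast, ← Real.rpow_mul hP.Delta_pos.le]
  norm_num

theorem widthCoeff_sq (hP : P.Regular) : P.widthCoeff ^ 2 = P.Delta ^ (2 / 3 : ℝ) := by
  rw [widthCoeff, ← Real.rpow_natCast, ← Real.rpow_mul hP.Delta_pos.le]
  norm_num

theorem mul_widthCoeff_cube (hP : P.Regular) :
    P.weightM⁻¹ * P.R * (4 / 3) * P.widthCoeff ^ 3 = 1 := by
  have := hP.R_pos.ne'
  have := hP.weightM_pos.ne'
  rw [hP.widthCoeff_cube, Delta_eq]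
  field_simp

end Regular

end Params

/-- A solution of the reduced problem together with a point `q` of its no-transaction region. The
size `h` is the cube root of the proportional round-trip cost. -/
structure ReducedPoint (P : Params) where
  h : ℝ
  L : ℝ
  a : ℝ
  b : ℝ
  g : ℝ → ℝ
  I : ℝ → ℝ
  G : ℝ → ℝ
  red : ReducedSolution P L a b g I G
  h_pos : 0 < h
  L_le : L ≤ h ^ 3
  abs_L_sub : |L - h ^ 3| ≤ h ^ 6
  q : ℝ
  mem : q ∈ Icc a b

namespace ReducedPoint

variable {P : Params}

instance : Sized (ReducedPoint P) := ⟨h, h_pos⟩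

/-- The same solution at another point. -/
def move (x : ReducedPoint P) (q : ℝ) (hq : q ∈ Icc x.a x.b) : ReducedPoint P :=
  { x with q := q, mem := hq }

/-- The same solution at the right boundary. -/
def right (x : ReducedPoint P) : ReducedPoint P := x.move x.b x.red.right_mem

/-- The deviation of the point from the Merton ratio. -/
noncomputable def dev (x : ReducedPoint P) : ℝ := x.q - P.qM

/-- The distance of the left boundary from the Merton ratio. -/
noncomputable def leftWidth (x : ReducedPoint P) : ℝ := P.qM - x.a

/-- The distance of the right boundary from the Merton ratio. -/
noncomputable def rightWidth (x : ReducedPoint P) : ℝ := x.b - P.qM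

/-- Half the width of the no-transaction region. -/
noncomputable def halfWidth (x : ReducedPoint P) : ℝ := (x.leftWidth + x.rightWidth) / 2

/-- The leading term of the scaled excess. -/
noncomputable def parabola (x : ReducedPoint P) : ℝ := P.R * (x.leftWidth ^ 2 - x.dev ^ 2)

/-- The factor between the scaled excess and the logarithmic derivative of the relative shadow
price. -/
noncomputable def weight (x : ReducedPoint P) : ℝ :=
  x.q * (1 - x.q) * (x.q * (1 - x.q) - x.g x.q)

theorem right_leftWidth (x : ReducedPoint P) : x.right.leftWidth = x.leftWidth := rfl

theorem right_dev (x : ReducedPoint P) : x.right.dev = x.rightWidth := rfl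

theorem right_I (x : ReducedPoint P) : x.right.I x.right.q = x.L := x.red.I_right

theorem right_g (x : ReducedPoint P) : x.right.g x.right.q = 0 := x.red.g_right

theorem leftWidth_pos (x : ReducedPoint P) : 0 < x.leftWidth := sub_pos.2 x.red.left_lt

theorem rightWidth_pos (x : ReducedPoint P) : 0 < x.rightWidth := sub_pos.2 x.red.lt_right

theorem L_nonneg (x : ReducedPoint P) : 0 ≤ x.L :=
  (x.red.I_nonneg x.red.right_mem).trans x.red.I_right.le

theorem weight_mul_G (x : ReducedPoint P) : x.weight * x.G x.q = x.g x.q := x.red.mul_G x.q x.mem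

theorem isOrder_right {n : ℕ} {f : ReducedPoint P → ℝ} (hf : IsOrder n f) :
    IsOrder n fun x : ReducedPoint P => f x.right :=
  hf.comp right fun _ => rfl

theorem isOrder_L : IsOrder 3 fun x : ReducedPoint P => x.L := by
  refine (IsOrder.size_pow 3).of_abs_le 1 (.of_forall fun x => ?_)
  rw [abs_of_nonneg x.L_nonneg, one_mul]
  exact x.L_le.trans (le_abs_self _)

theorem isOrder_L_sub : IsOrder 6 fun x : ReducedPoint P => x.L - size x ^ 3 := by
  refine (IsOrder.size_pow 6).of_abs_le 1 (.of_forall fun x => ?_)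
  rw [one_mul]
  exact x.abs_L_sub.trans (le_abs_self _)

theorem isOrder_I : IsOrder 3 fun x : ReducedPoint P => x.I x.q := by
  refine isOrder_L.of_abs_le 1 (.of_forall fun x => ?_)
  rw [one_mul, abs_of_nonneg x.L_nonneg, abs_of_nonneg (x.red.I_nonneg x.mem)]
  exact x.red.I_le x.mem

theorem isOrder_cubes (hR : 0 < P.R) :
    IsOrder 3 fun x : ReducedPoint P => x.leftWidth ^ 3 + x.rightWidth ^ 3 := by
  refine isOrder_L.of_abs_le
    ((P.weightBound + 3 * P.defectBound * P.fracBound) / (2 / 3 * P.R)) ?_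
  filter_upwards [(isOrder_L (P := P)).tendsto_zero.eventually_le_const one_pos] with x hL
  have := x.leftWidth_pos
  have := x.rightWidth_pos
  rw [abs_of_nonneg (by positivity), abs_of_nonneg x.L_nonneg]
  exact x.red.width_cube_le hR hL

theorem isOrder_leftWidth (hR : 0 < P.R) : IsOrder 1 fun x : ReducedPoint P => x.leftWidth := by
  refine .of_pow (k := 3) ((isOrder_cubes hR).of_abs_le 1 (.of_forall fun x => ?_))
  have := pow_pos x.leftWidth_pos 3
  have := pow_pos x.rightWidth_pos 3
  rw [one_mul]
  gcongr
  linarith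

theorem isOrder_rightWidth (hR : 0 < P.R) : IsOrder 1 fun x : ReducedPoint P => x.rightWidth := by
  refine .of_pow (k := 3) ((isOrder_cubes hR).of_abs_le 1 (.of_forall fun x => ?_))
  have := pow_pos x.leftWidth_pos 3
  have := pow_pos x.rightWidth_pos 3
  rw [one_mul]
  gcongr
  linarith

theorem isOrder_dev (hR : 0 < P.R) : IsOrder 1 fun x : ReducedPoint P => x.dev := by
  refine ((isOrder_leftWidth hR).add (isOrder_rightWidth hR)).of_abs_le 1 (.of_forall fun x => ?_)
  have := x.mem.1
  have := x.mem.2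
  have := x.leftWidth_pos
  have := x.rightWidth_pos
  rw [one_mul, abs_of_pos (add_pos x.leftWidth_pos x.rightWidth_pos), abs_le]
  simp only [leftWidth, rightWidth, dev] at *
  constructor <;> linarith

theorem isOrder_halfWidth (hR : 0 < P.R) : IsOrder 1 fun x : ReducedPoint P => x.halfWidth :=
  (((isOrder_leftWidth hR).add (isOrder_rightWidth hR)).const_mul (1 / 2)).of_eq fun x => by
    simp only [halfWidth]
    ring

theorem isOrder_of_hasDerivWithinAt (hR : 0 < P.R) {n : ℕ} {F f : ReducedPoint P → ℝ → ℝ}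
    (hf : IsOrder n fun x => f x x.q)
    (hmove : ∀ x t (ht : t ∈ Icc x.a x.b), f (x.move t ht) t = f x t) (h0 : ∀ x, F x x.a = 0)
    (hF : ∀ x, ∀ t ∈ Icc x.a x.b, HasDerivWithinAt (F x) (f x t) (Icc x.a x.b) t) :
    IsOrder (n + 1) fun x => F x x.q := by
  have hwidth : IsOrder 1 fun x : ReducedPoint P => x.q - x.a :=
    ((isOrder_leftWidth hR).add (isOrder_dev hR)).of_eq fun x => by simp only [leftWidth, dev]; ring
  have hsub (x : ReducedPoint P) : Icc x.a x.q ⊆ Icc x.a x.b := Icc_subset_Icc_right x.mem.2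
  refine (hf.image_sub hwidth (fun x => x.mem.1) (fun x t ht => (hF x t (hsub x ht)).mono (hsub x))
    fun x t ht => ⟨x.move t (hsub x ht), rfl, hmove x t (hsub x ht)⟩).of_eq fun x => ?_
  rw [h0, sub_zero]

theorem isOrder_g_sub_parabola (hP : P.Regular) :
    IsOrder 3 fun x : ReducedPoint P => x.g x.q - x.parabola := by
  refine isOrder_I.of_abs_le P.defectBound (.of_forall fun x => ?_)
  rw [abs_of_nonneg (x.red.I_nonneg x.mem)]
  exact x.red.abs_g_sub_le hP.R_pos x.mem

theorem isOrder_g (hP : P.Regular) : IsOrder 2 fun x : ReducedPoint P => x.g x.q := by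
  have hparabola : IsOrder 2 fun x : ReducedPoint P => x.parabola :=
    (((isOrder_leftWidth hP.R_pos).pow 2).sub ((isOrder_dev hP.R_pos).pow 2)).const_mul P.R
  exact ((isOrder_g_sub_parabola hP).mono.add hparabola).of_eq fun x => by ring

theorem isOrder_q (hP : P.Regular) : IsOrder 0 fun x : ReducedPoint P => x.q :=
  ((isOrder_dev hP.R_pos).mono.add (.const P.qM)).of_eq fun x => by simp only [dev]; ring

theorem isOrder_weight_sub_linear (hP : P.Regular) :
    IsOrder 2 fun x : ReducedPoint P => x.weight - P.weightM - P.weightSlope * x.dev := by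
  have hs := isOrder_dev hP.R_pos
  have hq := isOrder_q hP
  have hA : IsOrder 0 fun x : ReducedPoint P => x.q * (1 - x.q) := hq.mul ((IsOrder.const 1).sub hq)
  have hsq : IsOrder 2 fun x : ReducedPoint P =>
      ((1 - 2 * P.qM - x.dev) ^ 2 - 2 * (P.qM * (1 - P.qM))) * x.dev ^ 2 :=
    IsOrder.mul (n := 0) ((((IsOrder.const (1 - 2 * P.qM)).sub hs.mono).pow 2).sub (.const _))
      (hs.pow 2)
  refine (hsq.sub (hA.mul (isOrder_g hP))).of_eq fun x => ?_
  simp only [weight, Params.weightM, Params.weightSlope, dev]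
  ring

theorem isOrder_weight_sub (hP : P.Regular) :
    IsOrder 1 fun x : ReducedPoint P => x.weight - P.weightM :=
  ((isOrder_weight_sub_linear hP).mono.add
    ((isOrder_dev hP.R_pos).const_mul P.weightSlope)).of_eq fun x => by ring

theorem isOrder_G (hP : P.Regular) : IsOrder 2 fun x : ReducedPoint P => x.G x.q := by
  refine ((isOrder_g hP).of_eq fun x => ?_).cancel_of_tendsto
    (tendsto_sub_nhds_zero_iff.1 (isOrder_weight_sub hP).tendsto_zero) hP.weightM_pos.ne'
  rw [mul_comm, x.weight_mul_G]

theorem isOrder_G_sub_parabola (hP : P.Regular) :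
    IsOrder 3 fun x : ReducedPoint P => x.G x.q - P.weightM⁻¹ * x.parabola := by
  refine (((isOrder_g_sub_parabola hP).sub
    ((isOrder_G hP).mul (isOrder_weight_sub hP))).const_mul P.weightM⁻¹).of_eq fun x => ?_
  linear_combination P.weightM⁻¹ * x.weight_mul_G
    - x.G x.q * inv_mul_cancel₀ hP.weightM_pos.ne'

theorem isOrder_G_sub_g (hP : P.Regular) : IsOrder 4 fun x : ReducedPoint P =>
    x.G x.q - P.weightM⁻¹ * (x.g x.q - P.weightSlope * x.dev * (P.weightM⁻¹ * x.parabola)) := by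
  refine ((((isOrder_G hP).mul (isOrder_weight_sub_linear hP)).add
    (((isOrder_dev hP.R_pos).mul (isOrder_G_sub_parabola hP)).const_mul
      P.weightSlope)).const_mul (-P.weightM⁻¹)).of_eq fun x => ?_
  linear_combination P.weightM⁻¹ * x.weight_mul_G
    - x.G x.q * inv_mul_cancel₀ hP.weightM_pos.ne'

theorem isOrder_rate_sub (hP : P.Regular) :
    IsOrder 2 fun x : ReducedPoint P => P.rate x.g x.q - P.mM := by
  refine (((((isOrder_dev hP.R_pos).pow 2).const_mul P.R).add (isOrder_g hP)).const_mul
    P.gap).of_eq fun x => ?_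
  simp only [Params.rate, dev]
  ring

theorem isOrder_g_sub_parabola_add (hP : P.Regular) :
    IsOrder 4 fun x : ReducedPoint P => x.g x.q - x.parabola + P.excessSlope * x.I x.q := by
  have hderiv : IsOrder 3 fun x : ReducedPoint P =>
      P.excessSlope * x.G x.q - 2 / P.σ ^ 2 * (P.rate x.g x.q * x.q * x.G x.q) := by
    have hrate : IsOrder 1 fun x : ReducedPoint P => P.rate x.g x.q * x.q - P.mM * P.qM :=
      (((isOrder_rate_sub hP).mul (isOrder_q hP)).mono.add
        ((isOrder_dev hP.R_pos).const_mul P.mM)).of_eq fun x => by simp only [dev]; ring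
    refine (((isOrder_G hP).mul hrate).const_mul (-(2 / P.σ ^ 2))).of_eq fun x => ?_
    simp only [Params.excessSlope]
    ring
  refine isOrder_of_hasDerivWithinAt hP.R_pos
    (F := fun x q => x.g q - P.R * (x.leftWidth ^ 2 - (q - P.qM) ^ 2) + P.excessSlope * x.I q)
    (f := fun x q => P.excessSlope * x.G q - 2 / P.σ ^ 2 * (P.rate x.g q * q * x.G q))
    hderiv (fun _ _ _ => rfl) (fun x => ?_) fun x q hq => ?_
  · simp only [x.red.g_left, x.red.I_left, leftWidth]
    ring
  · have hsq := (hasDerivAt_sq_sub_sq_sub x.leftWidth P.qM q).const_mul P.R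
    exact (((x.red.deriv_g q hq).sub hsq.hasDerivWithinAt).add
      ((x.red.deriv_I q hq).const_mul P.excessSlope)).congr_deriv (by ring)

theorem isOrder_I_sub_cubic (hP : P.Regular) : IsOrder 4 fun x : ReducedPoint P =>
    x.I x.q - P.weightM⁻¹ * P.R * cubic x.leftWidth x.dev := by
  refine isOrder_of_hasDerivWithinAt hP.R_pos
    (F := fun x q => x.I q - P.weightM⁻¹ * P.R * cubic x.leftWidth (q - P.qM))
    (f := fun x q => x.G q - P.weightM⁻¹ * (P.R * (x.leftWidth ^ 2 - (q - P.qM) ^ 2)))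
    (isOrder_G_sub_parabola hP) (fun _ _ _ => rfl) (fun x => ?_) fun x q hq => ?_
  · rw [x.red.I_left, ← neg_sub P.qM, leftWidth, cubic_neg_self]
    ring
  · have hcubic := (hasDerivAt_cubic_sub x.leftWidth P.qM q).const_mul (P.weightM⁻¹ * P.R)
    exact ((x.red.deriv_I q hq).sub hcubic.hasDerivWithinAt).congr_deriv (by ring)

theorem isOrder_G_sub_cubic (hP : P.Regular) : IsOrder 4 fun x : ReducedPoint P =>
    x.G x.q - P.weightM⁻¹ * P.R * ((x.leftWidth ^ 2 - x.dev ^ 2) *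
      (1 - P.weightSlope * P.weightM⁻¹ * x.dev) -
        P.excessSlope * P.weightM⁻¹ * cubic x.leftWidth x.dev) := by
  refine (((isOrder_G_sub_g hP).add ((isOrder_g_sub_parabola_add hP).const_mul P.weightM⁻¹)).sub
    ((isOrder_I_sub_cubic hP).const_mul (P.weightM⁻¹ * P.excessSlope))).of_eq fun x => ?_
  simp only [parabola]
  ring

theorem isOrder_I_sub_quartic (hP : P.Regular) : IsOrder 5 fun x : ReducedPoint P =>
    x.I x.q - P.weightM⁻¹ * P.R * (cubic x.leftWidth x.dev +
      P.weightSlope * P.weightM⁻¹ * ((x.leftWidth ^ 2 - x.dev ^ 2) ^ 2 / 4) -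
        P.excessSlope * P.weightM⁻¹ * quartic x.leftWidth x.dev) := by
  refine isOrder_of_hasDerivWithinAt hP.R_pos
    (F := fun x q => x.I q - P.weightM⁻¹ * P.R * (cubic x.leftWidth (q - P.qM) +
      P.weightSlope * P.weightM⁻¹ * ((x.leftWidth ^ 2 - (q - P.qM) ^ 2) ^ 2 / 4) -
        P.excessSlope * P.weightM⁻¹ * quartic x.leftWidth (q - P.qM)))
    (f := fun x q => x.G q - P.weightM⁻¹ * P.R * ((x.leftWidth ^ 2 - (q - P.qM) ^ 2) *
      (1 - P.weightSlope * P.weightM⁻¹ * (q - P.qM)) -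
        P.excessSlope * P.weightM⁻¹ * cubic x.leftWidth (q - P.qM)))
    (isOrder_G_sub_cubic hP) (fun _ _ _ => rfl) (fun x => ?_) fun x q hq => ?_
  · rw [x.red.I_left, ← neg_sub P.qM, leftWidth, cubic_neg_self, quartic_neg_self]
    ring
  · have hsq := (((hasDerivAt_sq_sub_sq_sub x.leftWidth P.qM q).pow 2).div_const 4).const_mul
      (P.weightSlope * P.weightM⁻¹)
    have hquartic := (hasDerivAt_quartic_sub x.leftWidth P.qM q).const_mul
      (P.excessSlope * P.weightM⁻¹)
    refine ((x.red.deriv_I q hq).sub ((((hasDerivAt_cubic_sub x.leftWidth P.qM q).add hsq).sub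
      hquartic).const_mul (P.weightM⁻¹ * P.R)).hasDerivWithinAt).congr_deriv ?_
    simp only [Nat.cast_ofNat]
    ring

theorem isOrder_boundary (hP : P.Regular) : IsOrder 4 fun x : ReducedPoint P =>
    P.R * (x.leftWidth ^ 2 - x.rightWidth ^ 2) - P.excessSlope * x.L := by
  refine ((isOrder_right (isOrder_g_sub_parabola_add hP)).const_mul (-1)).of_eq fun x => ?_
  simp only [parabola, right_leftWidth, right_dev, right_I, right_g]
  ring

theorem isOrder_L_sub_cubic (hP : P.Regular) : IsOrder 4 fun x : ReducedPoint P =>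
    x.L - P.weightM⁻¹ * P.R * cubic x.leftWidth x.rightWidth := by
  simpa only [right_leftWidth, right_dev, right_I] using isOrder_right (isOrder_I_sub_cubic hP)

theorem isOrder_L_sub_quartic (hP : P.Regular) : IsOrder 5 fun x : ReducedPoint P =>
    x.L - P.weightM⁻¹ * P.R * (cubic x.leftWidth x.rightWidth +
      P.weightSlope * P.weightM⁻¹ * ((x.leftWidth ^ 2 - x.rightWidth ^ 2) ^ 2 / 4) -
        P.excessSlope * P.weightM⁻¹ * quartic x.leftWidth x.rightWidth) := by
  simpa only [right_leftWidth, right_dev, right_I] using isOrder_right (isOrder_I_sub_quartic hP)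

theorem size_isBigO_width (hP : P.Regular) : (fun x : ReducedPoint P => size x ^ 1)
    =O[smallSize _] fun x => x.leftWidth + x.rightWidth := by
  have hL : (fun x : ReducedPoint P => x.L)
      =O[smallSize _] fun x => size x ^ 2 * (x.leftWidth + x.rightWidth) := by
    refine ((isOrder_G hP).image_sub_isBigO (F := fun x => x.I) (a := fun x => x.a)
      (b := fun x => x.b) (fun x => x.red.lt.le) (fun x => x.red.deriv_I)
      fun x t ht => ⟨x.move t ht, rfl, rfl⟩).congr (fun x => ?_) fun x => ?_
    · rw [x.red.I_left, x.red.I_right, sub_zero]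
    · simp only [leftWidth, rightWidth]
      ring
  have hcube : (fun x : ReducedPoint P => size x ^ 3) =O[smallSize _] fun x => x.L := by
    refine IsEquivalent.isBigO_symm (IsBigO.trans_isLittleO isOrder_L_sub ?_)
    exact (isLittleO_pow_pow (by norm_num : 3 < 6)).comp_tendsto tendsto_size
  refine ((hcube.trans hL).mul (isBigO_refl (fun x => (size x ^ 2)⁻¹) _)).congr
    (fun x => ?_) fun x => ?_ <;>
  · have := (size_pos x).ne'
    field_simp

theorem isOrder_leftWidth_sub_rightWidth (hP : P.Regular) :
    IsOrder 2 fun x : ReducedPoint P => x.leftWidth - x.rightWidth := by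
  refine .cancel (k := 1) ?_ (size_isBigO_width hP)
  refine (((isOrder_boundary hP).mono.add (isOrder_L.const_mul P.excessSlope)).const_mul
    P.R⁻¹).of_eq fun x => ?_
  linear_combination (x.rightWidth ^ 2 - x.leftWidth ^ 2) * inv_mul_cancel₀ hP.R_pos.ne'

theorem isOrder_L_sub_cube (hP : P.Regular) : IsOrder 5 fun x : ReducedPoint P =>
    x.L - P.weightM⁻¹ * P.R * (4 / 3 * x.halfWidth ^ 3) := by
  have hdiff := isOrder_leftWidth_sub_rightWidth hP
  have hhalf := isOrder_halfWidth hP.R_pos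
  have hu := isOrder_leftWidth hP.R_pos
  have hv := isOrder_rightWidth hP.R_pos
  have hsq : IsOrder 3 fun x : ReducedPoint P => x.leftWidth ^ 2 - x.rightWidth ^ 2 :=
    (hdiff.mul (hu.add hv)).of_eq fun x => by ring
  have hquartic : IsOrder 5 fun x : ReducedPoint P =>
      quartic x.leftWidth x.rightWidth - 4 / 3 * x.halfWidth ^ 4 := by
    refine ((hdiff.mul ((hu.add hv).pow 3)).const_mul (1 / 6)).of_eq fun x => ?_
    simp only [quartic, halfWidth]
    ring
  have hleading : IsOrder 4 fun x : ReducedPoint P =>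
      x.L - P.weightM⁻¹ * P.R * (4 / 3 * x.halfWidth ^ 3) := by
    refine ((isOrder_L_sub_cubic hP).add
      ((hhalf.mul hsq).const_mul (P.weightM⁻¹ * P.R))).of_eq fun x => ?_
    simp only [cubic, halfWidth]
    ring
  have hsq_sq : IsOrder 5 fun x : ReducedPoint P => (x.leftWidth ^ 2 - x.rightWidth ^ 2) ^ 2 :=
    (hsq.pow 2).mono
  -- The boundary relation turns the term of order 4 in `cubic` into one that cancels `quartic`.
  refine (((isOrder_L_sub_quartic hP).add
    (((hsq_sq.const_mul (P.weightSlope * P.weightM⁻¹ / 4)).sub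
      (hquartic.const_mul (P.excessSlope * P.weightM⁻¹))).const_mul (P.weightM⁻¹ * P.R))).add
    (((hhalf.mul (isOrder_boundary hP)).const_mul P.weightM⁻¹).add
      ((hhalf.mul hleading).const_mul (P.weightM⁻¹ * P.excessSlope)))).of_eq fun x => ?_
  simp only [cubic, halfWidth]
  ring

theorem isOrder_halfWidth_sub (hP : P.Regular) :
    IsOrder 3 fun x : ReducedPoint P => x.halfWidth - P.widthCoeff * size x := by
  have hc := hP.widthCoeff_pos
  have hcubes : IsOrder 5 fun x : ReducedPoint P => (x.halfWidth - P.widthCoeff * size x) *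
      (x.halfWidth ^ 2 + x.halfWidth * (P.widthCoeff * size x) + (P.widthCoeff * size x) ^ 2) := by
    refine (((isOrder_L_sub_cube hP).const_mul (-P.widthCoeff ^ 3)).add
      (isOrder_L_sub.mono.const_mul (P.widthCoeff ^ 3))).of_eq fun x => ?_
    linear_combination -x.halfWidth ^ 3 * hP.mul_widthCoeff_cube
  refine .cancel (k := 2) hcubes (.of_bound (P.widthCoeff ^ 2)⁻¹ (.of_forall fun x => ?_))
  have hsize := size_pos x
  have hhalf : 0 < x.halfWidth := half_pos (add_pos x.leftWidth_pos x.rightWidth_pos)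
  rw [Real.norm_of_nonneg (by positivity), Real.norm_of_nonneg (by positivity),
    inv_mul_eq_div, le_div_iff₀ (by positivity)]
  nlinarith [mul_pos hhalf (mul_pos hc hsize), sq_nonneg x.halfWidth]

theorem isOrder_rate_expansion (hP : P.Regular) : IsOrder 4 fun x : ReducedPoint P =>
    P.rate x.g x.q - (P.mM + P.gap * P.R * (P.widthCoeff * size x) ^ 2 +
      P.gap * P.excessSlope * (size x ^ 3 / 2 - x.I x.q)) := by
  have hsq : IsOrder 4 fun x : ReducedPoint P =>
      (x.halfWidth - P.widthCoeff * size x) * (x.halfWidth + P.widthCoeff * size x) :=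
    (isOrder_halfWidth_sub hP).mul
      ((isOrder_halfWidth hP.R_pos).add (IsOrder.size_self.const_mul P.widthCoeff))
  have hdiff := (isOrder_leftWidth_sub_rightWidth hP).pow 2
  refine ((((isOrder_g_sub_parabola_add hP).add ((hsq.add (hdiff.const_mul (1 / 4))).const_mul
    P.R)).add (((isOrder_boundary hP).add (isOrder_L_sub.mono.const_mul
      P.excessSlope)).const_mul (1 / 2))).const_mul P.gap).of_eq fun x => ?_
  simp only [Params.rate, parabola, halfWidth, dev]
  ring

theorem isOrder_I_sub_cubic_size (hP : P.Regular) : IsOrder 4 fun x : ReducedPoint P =>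
    x.I x.q - P.weightM⁻¹ * P.R * cubic (P.widthCoeff * size x) x.dev := by
  have hc : IsOrder 1 fun x : ReducedPoint P => P.widthCoeff * size x :=
    IsOrder.size_self.const_mul P.widthCoeff
  have hu := isOrder_leftWidth hP.R_pos
  have hsub : IsOrder 2 fun x : ReducedPoint P => x.leftWidth - P.widthCoeff * size x :=
    ((isOrder_halfWidth_sub hP).mono.add
      ((isOrder_leftWidth_sub_rightWidth hP).const_mul (1 / 2))).of_eq fun x => by
        simp only [halfWidth]
        ring
  refine ((isOrder_I_sub_cubic hP).add (((hsub.mul ((hu.add hc).mul (isOrder_dev hP.R_pos))).add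
    ((hsub.mul (((hu.pow 2).add (hu.mul hc)).add (hc.pow 2))).const_mul (2 / 3))).const_mul
      (P.weightM⁻¹ * P.R))).of_eq fun x => ?_
  simp only [cubic]
  ring

end ReducedPoint

/-! ### Reduction of the free boundary problem -/

/-- The scaled excess of the consumption rate over its frictionless value. -/
noncomputable def excess (P : Params) (n : ℝ → ℝ) (q : ℝ) : ℝ := (n q - P.m q) / P.gap

/-- The rate of decrease of the logarithm of the relative shadow price. -/
noncomputable def logSlope (κ : ℝ → ℝ) (a b q : ℝ) : ℝ := -(derivWithin κ (Icc a b) q / κ q)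

theorem Params.continuous_m (P : Params) : Continuous P.m := by
  unfold Params.m
  fun_prop

theorem Params.Regular.hasDerivAt_m {P : Params} (hP : P.Regular) (q : ℝ) :
    HasDerivAt P.m (2 * P.gap * P.R * (q - P.qM)) q := by
  rw [show P.m = fun q => P.mM + P.gap * P.R * (q - P.qM) ^ 2 from
    funext (Params.m_eq hP.σ_pos.ne' hP.R_pos.ne')]
  refine (((((hasDerivAt_id q).sub_const P.qM).pow 2).const_mul
    (P.gap * P.R)).const_add P.mM).congr_deriv ?_
  simp only [id, Nat.cast_ofNat]
  ring

theorem rate_excess {P : Params} (hP : P.Regular) (n : ℝ → ℝ) (q : ℝ) :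
    P.rate (excess P n) q = n q := by
  rw [Params.rate, excess, mul_add, mul_div_cancel₀ _ hP.gap_ne,
    Params.m_eq hP.σ_pos.ne' hP.R_pos.ne']
  ring

theorem gap_mul_excess {P : Params} (hP : P.Regular) (n : ℝ → ℝ) (q : ℝ) :
    P.gap * excess P n q = n q - P.m q :=
  mul_div_cancel₀ _ hP.gap_ne

theorem gap_mul_sub_excess {P : Params} (hP : P.Regular) (n : ℝ → ℝ) (q : ℝ) :
    P.gap * (q * (1 - q) - excess P n q) = P.ell q - n q := by
  rw [mul_sub, ← P.ell_sub_m, gap_mul_excess hP]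
  ring

theorem div_ell_sub_eq {P : Params} (hP : P.Regular) (n : ℝ → ℝ) (q : ℝ) :
    (P.m q - n q) / (P.ell q - n q) = -(excess P n q / (q * (1 - q) - excess P n q)) := by
  rw [← gap_mul_sub_excess hP, ← neg_sub, ← gap_mul_excess hP, neg_div,
    mul_div_mul_left _ _ hP.gap_ne]

namespace FreeBoundary

variable {P : Params} {ξ a b : ℝ} {n : ℝ → ℝ}

theorem left_lt (h : FreeBoundary P ξ a b n) (hP : P.Regular) : a < P.qM := by
  rcases hP.qM_ne_zero.lt_or_gt with h0 | h0
  · exact (h.loc_neg h0).2.1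
  rcases hP.qM_ne_one.lt_or_gt with h1 | h1
  · exact (h.loc_mid h0 h1).2.1
  · exact (h.loc_big h1).2.1

theorem lt_right (h : FreeBoundary P ξ a b n) (hP : P.Regular) : P.qM < b := by
  rcases hP.qM_ne_zero.lt_or_gt with h0 | h0
  · exact (h.loc_neg h0).2.2.1
  rcases hP.qM_ne_one.lt_or_gt with h1 | h1
  · exact (h.loc_mid h0 h1).2.2.1
  · exact (h.loc_big h1).2.2.1

theorem lt (h : FreeBoundary P ξ a b n) (hP : P.Regular) : a < b :=
  (h.left_lt hP).trans (h.lt_right hP)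

theorem ne_zero (h : FreeBoundary P ξ a b n) (hP : P.Regular) {q : ℝ} (hq : q ∈ Icc a b) :
    q ≠ 0 := by
  rcases hP.qM_ne_zero.lt_or_gt with h0 | h0
  · exact (hq.2.trans_lt (h.loc_neg h0).2.2.2).ne
  rcases hP.qM_ne_one.lt_or_gt with h1 | h1
  · exact ((h.loc_mid h0 h1).1.trans_le hq.1).ne'
  · exact ((h.loc_big h1).1.trans_le hq.1).ne'

theorem mul_one_sub_ne_zero (h : FreeBoundary P ξ a b n) (hP : P.Regular) {q : ℝ}
    (hq : q ∈ Icc a b) (h1 : q ≠ 1) : q * (1 - q) ≠ 0 :=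
  mul_ne_zero (h.ne_zero hP hq) (sub_ne_zero.2 h1.symm)

theorem abs_q_le (h : FreeBoundary P ξ a b n) (hP : P.Regular) {q : ℝ} (hq : q ∈ Icc a b) :
    |q| ≤ 2 * |P.qM| + 1 := by
  obtain ⟨haq, hqb⟩ := hq
  rw [abs_le]
  rcases hP.qM_ne_zero.lt_or_gt with h0 | h0
  · have := h.loc_neg h0
    rw [abs_of_neg h0]
    constructor <;> linarith
  rw [abs_of_pos h0]
  rcases hP.qM_ne_one.lt_or_gt with h1 | h1
  · have := h.loc_mid h0 h1
    constructor <;> linarith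
  · have := h.loc_big h1
    constructor <;> linarith

theorem excess_left (h : FreeBoundary P ξ a b n) : excess P n a = 0 := by
  rw [excess, h.bd_left, sub_self, zero_div]

theorem excess_right (h : FreeBoundary P ξ a b n) : excess P n b = 0 := by
  rw [excess, h.bd_right, sub_self, zero_div]

theorem excess_one (h : FreeBoundary P ξ a b n) (h1 : 1 ∈ Icc a b) : excess P n 1 = 0 := by
  rw [excess, (h.at_one h1).1, sub_self, zero_div]

theorem continuousOn_excess (h : FreeBoundary P ξ a b n) :
    ContinuousOn (excess P n) (Icc a b) :=
  (h.contDiff.continuousOn.sub P.continuous_m.continuousOn).div_const _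

theorem sub_excess_ne_zero (h : FreeBoundary P ξ a b n) (hP : P.Regular) {q : ℝ}
    (hq : q ∈ Icc a b) (h1 : q ≠ 1) : q * (1 - q) - excess P n q ≠ 0 := fun h0 => by
  have hell := gap_mul_sub_excess hP n q
  rw [h0, mul_zero] at hell
  exact h.ne_ell q hq h1 (sub_eq_zero.1 hell.symm).symm

/-- The weight is positive at the boundary on the same side of `1`, and it does not vanish in
between. -/
theorem weight_pos (h : FreeBoundary P ξ a b n) (hP : P.Regular) {q : ℝ} (hq : q ∈ Icc a b)
    (h1 : q ≠ 1) : 0 < q * (1 - q) * (q * (1 - q) - excess P n q) := by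
  have hcont : ContinuousOn (fun q => q * (1 - q) * (q * (1 - q) - excess P n q)) (Icc a b) :=
    ContinuousOn.mul (by fun_prop) (ContinuousOn.sub (by fun_prop) h.continuousOn_excess)
  have hne : ∀ x ∈ Icc a b, x ≠ 1 → x * (1 - x) * (x * (1 - x) - excess P n x) ≠ 0 :=
    fun x hx hx1 => mul_ne_zero (h.mul_one_sub_ne_zero hP hx hx1) (h.sub_excess_ne_zero hP hx hx1)
  have hpos : ∀ x ∈ Icc a b, x ≠ 1 → excess P n x = 0 →
      0 < x * (1 - x) * (x * (1 - x) - excess P n x) := fun x hx hx1 hx0 => by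
    rw [hx0, sub_zero]
    exact mul_self_pos.2 (h.mul_one_sub_ne_zero hP hx hx1)
  rcases h1.lt_or_gt with h1 | h1
  · have hsub : Icc a q ⊆ Icc a b := Icc_subset_Icc_right hq.2
    exact pos_of_ne_zero_of_pos ordConnected_Icc (hcont.mono hsub)
      (fun x hx => hne x (hsub hx) (hx.2.trans_lt h1).ne) (left_mem_Icc.2 hq.1)
      (right_mem_Icc.2 hq.1) (hpos a (left_mem_Icc.2 (h.lt hP).le) (hq.1.trans_lt h1).ne
        h.excess_left)
  · have hsub : Icc q b ⊆ Icc a b := Icc_subset_Icc_left hq.1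
    exact pos_of_ne_zero_of_pos ordConnected_Icc (hcont.mono hsub)
      (fun x hx => hne x (hsub hx) (h1.trans_le hx.1).ne') (right_mem_Icc.2 hq.2)
      (left_mem_Icc.2 hq.2) (hpos b (right_mem_Icc.2 (h.lt hP).le) (h1.trans_le hq.2).ne'
        h.excess_right)

theorem weight_nonneg (h : FreeBoundary P ξ a b n) (hP : P.Regular) {q : ℝ} (hq : q ∈ Icc a b) :
    0 ≤ q * (1 - q) * (q * (1 - q) - excess P n q) := by
  by_cases h1 : q = 1
  · simp [h1]
  · exact (h.weight_pos hP hq h1).le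

theorem m_le_rateBound (h : FreeBoundary P ξ a b n) (hP : P.Regular) {q : ℝ} (hq : q ∈ Icc a b) :
    P.m q ≤ P.rateBound := by
  have hdev : |q - P.qM| ≤ P.fracBound := by
    unfold Params.fracBound
    linarith [abs_sub q P.qM, h.abs_q_le hP hq]
  have hR := hP.R_pos
  rw [Params.m_eq hP.σ_pos.ne' hR.ne', Params.rateBound, ← sq_abs (q - P.qM)]
  gcongr
  exacts [le_abs_self _, le_abs_self _]

theorem le_rateBound (h : FreeBoundary P ξ a b n) (hP : P.Regular) {q : ℝ} (hq : q ∈ Icc a b) :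
    n q ≤ P.rateBound := by
  have ha : a ∈ Icc a b := left_mem_Icc.2 (h.lt hP).le
  have hb : b ∈ Icc a b := right_mem_Icc.2 (h.lt hP).le
  rcases (mul_ne_zero (sub_ne_zero.2 hP.R_ne_one.symm) hP.qM_ne_zero).lt_or_gt with hlt | hgt
  · exact (h.mono hlt hq hb hq.2).trans (h.bd_right.trans_le (h.m_le_rateBound hP hb))
  · exact (h.anti hgt ha hq hq.1).trans (h.bd_left.trans_le (h.m_le_rateBound hP ha))

end FreeBoundary

namespace RelShadowPrice

variable {P : Params} {γu γd ξ a b : ℝ} {n κ : ℝ → ℝ}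

theorem logSlope_nonneg (h : RelShadowPrice P γu γd a b n κ) {q : ℝ} (hq : q ∈ Icc a b) :
    0 ≤ logSlope κ a b q :=
  neg_nonneg.2 (div_nonpos_of_nonpos_of_nonneg h.anti.derivWithin_nonpos (h.pos q hq).le)

theorem continuousOn_logSlope (h : RelShadowPrice P γu γd a b n κ) (hab : a < b) :
    ContinuousOn (logSlope κ a b) (Icc a b) :=
  ((h.contDiff.continuousOn_derivWithin (uniqueDiffOn_Icc hab) le_rfl).div h.contDiff.continuousOn
    fun q hq => (h.pos q hq).ne').neg

theorem hasDerivWithinAt_log (h : RelShadowPrice P γu γd a b n κ) {q : ℝ} (hq : q ∈ Icc a b) :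
    HasDerivWithinAt (fun q => Real.log γu - Real.log (κ q)) (logSlope κ a b q) (Icc a b) q :=
  ((h.contDiff.differentiableOn one_ne_zero q hq).hasDerivWithinAt.log (h.pos q hq).ne').const_sub _

theorem logSlope_eq (h : RelShadowPrice P γu γd a b n κ) (hP : P.Regular) {q : ℝ}
    (hq : q ∈ Icc a b) (h1 : q ≠ 1) :
    logSlope κ a b q = excess P n q / (q * (1 - q) * (q * (1 - q) - excess P n q)) := by
  rw [logSlope, h.ode q hq h1, div_ell_sub_eq hP, mul_div_right_comm,
    div_right_comm, div_self (h.pos q hq).ne', mul_neg, neg_neg, div_mul_div_comm, one_mul]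

theorem weight_mul_logSlope (h : RelShadowPrice P γu γd a b n κ) (hF : FreeBoundary P ξ a b n)
    (hP : P.Regular) {q : ℝ} (hq : q ∈ Icc a b) :
    q * (1 - q) * (q * (1 - q) - excess P n q) * logSlope κ a b q = excess P n q := by
  by_cases h1 : q = 1
  · subst h1
    rw [hF.excess_one hq]
    ring
  · rw [h.logSlope_eq hP hq h1, mul_div_cancel₀ _ (hF.weight_pos hP hq h1).ne']

theorem derivWithin_rate_eqOn (h : RelShadowPrice P γu γd a b n κ) (hF : FreeBoundary P ξ a b n)
    (hP : P.Regular) : EqOn (derivWithin n (Icc a b))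
      (fun q => -(P.gap * (2 / P.σ ^ 2)) * (n q * q * logSlope κ a b q)) (Icc a b) := by
  have hab := hF.lt hP
  -- Both sides are continuous, so the singular point `1` can be omitted.
  refine EqOn.of_subset_closure (s := Icc a b \ {1}) ?_
    (hF.contDiff.continuousOn_derivWithin (uniqueDiffOn_Icc hab) le_rfl)
    (continuousOn_const.mul
      ((hF.contDiff.continuousOn.mul continuousOn_id).mul (h.continuousOn_logSlope hab)))
    sdiff_subset (Icc_subset_closure_diff_singleton hab 1)
  rintro q ⟨hq, h1 : q ≠ 1⟩
  have hq0 := hF.ne_zero hP hq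
  have h1q : 1 - q ≠ 0 := sub_ne_zero.2 h1.symm
  have hgap : (1 - P.S) / P.S = P.gap * (2 / P.σ ^ 2) := by
    have := hP.σ_pos.ne'
    rw [Params.gap]
    field_simp
  beta_reduce
  rw [hF.ode q hq h1, h.logSlope_eq hP hq h1, div_ell_sub_eq hP, hgap, ← div_div (excess P n q),
    div_right_comm (excess P n q)]
  generalize excess P n q / _ = e
  field_simp

theorem hasDerivWithinAt_excess (h : RelShadowPrice P γu γd a b n κ)
    (hF : FreeBoundary P ξ a b n) (hP : P.Regular) {q : ℝ} (hq : q ∈ Icc a b) :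
    HasDerivWithinAt (excess P n) (-(2 * P.R * (q - P.qM)) -
      2 / P.σ ^ 2 * (P.rate (excess P n) q * q * logSlope κ a b q)) (Icc a b) q := by
  have hn := (hF.contDiff.differentiableOn one_ne_zero q hq).hasDerivWithinAt
  refine ((hn.sub (hP.hasDerivAt_m q).hasDerivWithinAt).div_const P.gap).congr_deriv ?_
  have hgap := hP.gap_ne
  rw [h.derivWithin_rate_eqOn hF hP hq, rate_excess hP]
  field_simp
  ring

end RelShadowPrice

theorem ShadowData.Solves.reducedSolution {P : Params} (hP : P.Regular) {D : ShadowData}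
    {γu γd : ℝ} (hu : 0 < γu) (hd : 0 < γd) (h : D.Solves P γu γd) :
    ReducedSolution P (Real.log (γu * γd)) D.qLow D.qHigh (excess P D.n)
      (fun q => Real.log γu - Real.log (D.κ q)) (logSlope D.κ D.qLow D.qHigh) := by
  have hF := h.free_boundary
  have hκ := h.shadow_price
  exact {
    left_lt := hF.left_lt hP
    lt_right := hF.lt_right hP
    abs_q_le := fun q hq => hF.abs_q_le hP hq
    g_left := hF.excess_left
    g_right := hF.excess_right
    I_left := by rw [hκ.bd_left, sub_self]
    I_right := by
      rw [hκ.bd_right, Real.log_mul hu.ne' hd.ne', one_div, Real.log_inv, sub_neg_eq_add]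
    deriv_I := fun q hq => hκ.hasDerivWithinAt_log hq
    deriv_g := fun q hq => hκ.hasDerivWithinAt_excess hF hP hq
    g_nonneg := fun q hq => by
      rw [← hκ.weight_mul_logSlope hF hP hq]
      exact mul_nonneg (hF.weight_nonneg hP hq) (hκ.logSlope_nonneg hq)
    G_nonneg := fun q hq => hκ.logSlope_nonneg hq
    mul_G := fun q hq => hκ.weight_mul_logSlope hF hP hq
    rate_le := fun q hq => by
      rw [rate_excess hP, abs_of_pos (hF.pos q hq)]
      exact hF.le_rateBound hP hq }

/-! ### Expansion of the optimal consumption -/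

/-- Optimal consumption per unit of wealth, when the fraction `p` of wealth is invested in the risky
asset. -/
noncomputable def ShadowData.consumptionRate (D : ShadowData) (p : ℝ) : ℝ :=
  (1 + p * (D.κ (D.sf p) - 1)) * D.n (D.sf p)

/-- The expansion of the optimal consumption per unit of wealth, up to terms of order
`ε ^ (4 / 3)`. The factor `mM` is distributed, so that the case `mM = 0` is included. -/
noncomputable def Params.rateExpansion (P : Params) (εu εd ε p : ℝ) : ℝ :=
  P.mM + P.gap * P.R * P.Delta ^ (2 / 3 : ℝ) * (εu + εd) ^ (2 / 3 : ℝ) +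
    P.mM * (P.qM / (2 * P.S) *
      (1 - 1 / 2 * h3 ((p - P.qM) / (P.Delta ^ (1 / 3 : ℝ) * ε ^ (1 / 3 : ℝ)))) * (εu + εd) +
        P.qM / 2 * (εu - εd))

theorem abs_log_one_add_sub_self_le {e : ℝ} (he : 0 ≤ e) : |Real.log (1 + e) - e| ≤ e ^ 2 := by
  have hpos : 0 < 1 + e := by positivity
  have hupper := Real.log_le_sub_one_of_pos hpos
  have hlower := Real.one_sub_inv_le_log_of_pos hpos
  have hinv : e - e ^ 2 ≤ 1 - (1 + e)⁻¹ := by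
    have : 1 - (1 + e)⁻¹ - (e - e ^ 2) = e ^ 3 * (1 + e)⁻¹ := by
      field_simp
      ring
    have : 0 ≤ e ^ 3 * (1 + e)⁻¹ := by positivity
    linarith
  rw [abs_le]
  constructor <;> linarith [sq_nonneg e]

/-- Shadow data for some transaction costs, together with a point `p` of the real no-transaction
region. Its size is the cube root of the proportional round-trip cost. -/
structure NoTradePoint (P : Params) where
  D : ShadowData
  εu : ℝ
  εd : ℝ
  εu_pos : 0 < εu
  εd_pos : 0 < εd
  sol : D.Solves P (1 + εu) (1 + εd)
  p : ℝ
  mem : p ∈ Icc (D.pLow (1 + εu)) (D.pHigh (1 + εd))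

namespace NoTradePoint

variable {P : Params}

/-- The proportional round-trip transaction cost. -/
def cost (x : NoTradePoint P) : ℝ := (1 + x.εu) * (1 + x.εd) - 1

theorem cost_eq (x : NoTradePoint P) : x.cost = x.εu + x.εd + x.εu * x.εd := by
  rw [cost]
  ring

theorem one_add_cost (x : NoTradePoint P) : 1 + x.cost = (1 + x.εu) * (1 + x.εd) :=
  add_sub_cancel _ _

theorem cost_pos (x : NoTradePoint P) : 0 < x.cost := by
  have := x.εu_pos
  have := x.εd_pos
  rw [cost_eq]
  positivity

noncomputable instance : Sized (NoTradePoint P) where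
  size x := x.cost ^ (1 / 3 : ℝ)
  size_pos x := Real.rpow_pos_of_pos x.cost_pos _

theorem size_pow_eq (x : NoTradePoint P) (n : ℕ) : size x ^ n = x.cost ^ (n / 3 : ℝ) := by
  change (x.cost ^ (1 / 3 : ℝ)) ^ n = _
  rw [← Real.rpow_natCast, ← Real.rpow_mul x.cost_pos.le, one_div_mul_eq_div]

theorem size_cube (x : NoTradePoint P) : size x ^ 3 = x.cost := by
  rw [size_pow_eq]
  norm_num

/-- The corresponding point of the shadow no-transaction region. -/
noncomputable def toReducedPoint (hP : P.Regular) (x : NoTradePoint P) : ReducedPoint P where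
  h := size x
  L := Real.log ((1 + x.εu) * (1 + x.εd))
  a := x.D.qLow
  b := x.D.qHigh
  g := excess P x.D.n
  I := fun q => Real.log (1 + x.εu) - Real.log (x.D.κ q)
  G := logSlope x.D.κ x.D.qLow x.D.qHigh
  red := x.sol.reducedSolution hP (by linarith [x.εu_pos]) (by linarith [x.εd_pos])
  h_pos := size_pos x
  L_le := by
    rw [size_cube, ← one_add_cost]
    linarith [Real.log_le_sub_one_of_pos (show 0 < 1 + x.cost by linarith [x.cost_pos])]
  abs_L_sub := by
    rw [show size x ^ 6 = (size x ^ 3) ^ 2 by ring, size_cube, ← one_add_cost]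
    exact abs_log_one_add_sub_self_le x.cost_pos.le
  q := x.D.sf x.p
  mem := x.sol.shadow_fraction.mapsTo x.mem

theorem isOrder_toReducedPoint (hP : P.Regular) {n : ℕ} {f : ReducedPoint P → ℝ}
    (hf : IsOrder n f) : IsOrder n fun x : NoTradePoint P => f (x.toReducedPoint hP) :=
  hf.comp (toReducedPoint hP) fun _ => rfl

theorem isOrder_cost : IsOrder 3 fun x : NoTradePoint P => x.cost :=
  (IsOrder.size_pow 3).of_eq fun x => x.size_cube.symm

theorem isOrder_εu : IsOrder 3 fun x : NoTradePoint P => x.εu := by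
  refine isOrder_cost.of_abs_le 1 (.of_forall fun x => ?_)
  rw [abs_of_pos x.εu_pos, abs_of_pos x.cost_pos, cost_eq]
  linarith [x.εd_pos, mul_pos x.εu_pos x.εd_pos]

theorem isOrder_εd : IsOrder 3 fun x : NoTradePoint P => x.εd := by
  refine isOrder_cost.of_abs_le 1 (.of_forall fun x => ?_)
  rw [abs_of_pos x.εd_pos, abs_of_pos x.cost_pos, cost_eq]
  linarith [x.εu_pos, mul_pos x.εu_pos x.εd_pos]

theorem isOrder_size_sq_sub :
    IsOrder 5 fun x : NoTradePoint P => size x ^ 2 - (x.εu + x.εd) ^ (2 / 3 : ℝ) := by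
  refine .cancel (k := 1) (g := size) ((isOrder_εu.mul isOrder_εd).of_abs_le 1
    (.of_forall fun x => ?_)) (by simpa only [pow_one] using isBigO_refl _ _)
  have hu := x.εu_pos
  have hd := x.εd_pos
  have hs := size_pos x
  have hc := x.cost_pos
  have hle : x.εu + x.εd ≤ x.cost := by
    rw [cost_eq]
    linarith [mul_pos hu hd]
  have hupper : (x.εu + x.εd) ^ (2 / 3 : ℝ) ≤ size x ^ 2 := by
    rw [size_pow_eq, Nat.cast_ofNat]
    gcongr
  have hlower : size x ^ 2 * ((x.εu + x.εd) / x.cost) ≤ (x.εu + x.εd) ^ (2 / 3 : ℝ) :=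
    calc size x ^ 2 * ((x.εu + x.εd) / x.cost)
        ≤ x.cost ^ (2 / 3 : ℝ) * ((x.εu + x.εd) / x.cost) ^ (2 / 3 : ℝ) := by
          rw [size_pow_eq, Nat.cast_ofNat]
          gcongr
          exact Real.self_le_rpow_of_le_one (by positivity) ((div_le_one hc).2 hle) (by norm_num)
      _ = (x.εu + x.εd) ^ (2 / 3 : ℝ) := by
          rw [← Real.mul_rpow hc.le (by positivity), mul_div_cancel₀ _ hc.ne']
  rw [one_mul, abs_of_nonneg (mul_nonneg (sub_nonneg.2 hupper) hs.le), abs_of_pos (mul_pos hu hd)]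
  calc (size x ^ 2 - (x.εu + x.εd) ^ (2 / 3 : ℝ)) * size x
      ≤ (size x ^ 2 - size x ^ 2 * ((x.εu + x.εd) / x.cost)) * size x := by gcongr
    _ = x.cost - (x.εu + x.εd) := by
      rw [← x.size_cube]
      field_simp
    _ = x.εu * x.εd := by
      rw [cost_eq]
      ring

theorem isOrder_qLow_sub (hP : P.Regular) :
    IsOrder 1 fun x : NoTradePoint P => x.D.qLow - P.qM :=
  ((isOrder_toReducedPoint hP (ReducedPoint.isOrder_leftWidth hP.R_pos)).const_mul (-1)).of_eq
    fun x => by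
      simp only [ReducedPoint.leftWidth, toReducedPoint]
      ring

theorem isOrder_qHigh_sub (hP : P.Regular) :
    IsOrder 1 fun x : NoTradePoint P => x.D.qHigh - P.qM :=
  isOrder_toReducedPoint hP (ReducedPoint.isOrder_rightWidth hP.R_pos)

theorem isOrder_of_sub_qM {z : NoTradePoint P → ℝ} (hz : IsOrder 1 fun x => z x - P.qM) :
    IsOrder 0 z :=
  (hz.mono.add (.const P.qM)).of_eq fun x => by ring

theorem isOrder_pLow_sub_qLow (hP : P.Regular) :
    IsOrder 3 fun x : NoTradePoint P => x.D.pLow (1 + x.εu) - x.D.qLow := by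
  have ha := isOrder_of_sub_qM (isOrder_qLow_sub hP)
  refine (ha.div_one_add_sub (isOrder_εu.mul ((IsOrder.const 1).sub ha))).of_eq fun x => ?_
  have hu : 1 + x.εu ≠ 0 := by linarith [x.εu_pos]
  have hden : 1 + (1 / (1 + x.εu) - 1) * x.D.qLow
      = (1 + x.εu * (1 - x.D.qLow)) / (1 + x.εu) := by
    field_simp
    ring
  rw [ShadowData.pLow, mobius, hden, one_div_mul_eq_div, div_div_div_cancel_right₀ hu]

theorem isOrder_pHigh_sub_qHigh (hP : P.Regular) :
    IsOrder 3 fun x : NoTradePoint P => x.D.pHigh (1 + x.εd) - x.D.qHigh := by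
  have hb := isOrder_of_sub_qM (isOrder_qHigh_sub hP)
  have hnum : IsOrder 0 fun x : NoTradePoint P => (1 + x.εd) * x.D.qHigh :=
    ((IsOrder.const 1).add isOrder_εd.mono).mul hb
  refine ((hnum.div_one_add_sub (isOrder_εd.mul hb)).add (isOrder_εd.mul hb)).of_eq fun x => ?_
  rw [ShadowData.pHigh, mobius]
  ring

theorem isOrder_pLow_sub (hP : P.Regular) :
    IsOrder 1 fun x : NoTradePoint P => x.D.pLow (1 + x.εu) - P.qM :=
  ((isOrder_pLow_sub_qLow hP).mono.add (isOrder_qLow_sub hP)).of_eq fun x => by ring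

theorem isOrder_pHigh_sub (hP : P.Regular) :
    IsOrder 1 fun x : NoTradePoint P => x.D.pHigh (1 + x.εd) - P.qM :=
  ((isOrder_pHigh_sub_qHigh hP).mono.add (isOrder_qHigh_sub hP)).of_eq fun x => by ring

theorem isOrder_p_sub (hP : P.Regular) : IsOrder 1 fun x : NoTradePoint P => x.p - P.qM := by
  have hsum : IsOrder 1 fun x : NoTradePoint P =>
      |x.D.pLow (1 + x.εu) - P.qM| + |x.D.pHigh (1 + x.εd) - P.qM| :=
    IsBigO.add (isOrder_pLow_sub hP).abs_left (isOrder_pHigh_sub hP).abs_left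
  refine hsum.of_abs_le 1 (.of_forall fun x => ?_)
  have hlow := abs_nonneg (x.D.pLow (1 + x.εu) - P.qM)
  have hhigh := abs_nonneg (x.D.pHigh (1 + x.εd) - P.qM)
  rw [one_mul, abs_of_nonneg (add_nonneg hlow hhigh), abs_le]
  constructor
  · linarith [x.mem.1, neg_abs_le (x.D.pLow (1 + x.εu) - P.qM)]
  · linarith [x.mem.2, le_abs_self (x.D.pHigh (1 + x.εd) - P.qM)]

theorem isOrder_sf_sub_qM (hP : P.Regular) :
    IsOrder 1 fun x : NoTradePoint P => x.D.sf x.p - P.qM :=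
  isOrder_toReducedPoint hP (ReducedPoint.isOrder_dev hP.R_pos)

theorem isOrder_mul_one_sub_sub {z : NoTradePoint P → ℝ} (hz : IsOrder 1 fun x => z x - P.qM) :
    IsOrder 1 fun x => z x * (1 - z x) - P.qM * (1 - P.qM) :=
  ((hz.const_mul (1 - 2 * P.qM)).sub (hz.pow 2).mono).of_eq fun x => by ring

theorem isOrder_derivWithin_sf_sub_one (hP : P.Regular) : IsOrder 1 fun x : NoTradePoint P =>
    derivWithin x.D.sf (Icc (x.D.pLow (1 + x.εu)) (x.D.pHigh (1 + x.εd))) x.p - 1 := by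
  have hp := isOrder_mul_one_sub_sub (isOrder_p_sub hP)
  have hq := isOrder_mul_one_sub_sub (isOrder_sf_sub_qM hP)
  have hg : IsOrder 2 fun x : NoTradePoint P => excess P x.D.n (x.D.sf x.p) :=
    isOrder_toReducedPoint hP (ReducedPoint.isOrder_g hP)
  have hlim := tendsto_sub_nhds_zero_iff.1 hp.tendsto_zero
  have hne : P.qM * (1 - P.qM) ≠ 0 :=
    mul_ne_zero hP.qM_ne_zero (sub_ne_zero.2 hP.qM_ne_one.symm)
  refine .cancel_of_tendsto (((hq.sub hg.mono).sub hp).of_abs_le 1 ?_) hlim hne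
  filter_upwards [hlim.eventually_ne hne] with x hx
  have hp1 : x.p ≠ 1 := fun h1 => hx (by rw [h1, sub_self, mul_zero])
  rw [x.sol.shadow_fraction.ode x.p x.mem hp1, P.ell_sub_m, ← gap_mul_sub_excess hP, one_mul,
    mul_div_mul_left _ _ hP.gap_ne, sub_mul, div_mul_cancel₀ _ hx]
  apply le_of_eq
  congr 1
  ring

theorem isOrder_sf_sub (hP : P.Regular) : IsOrder 2 fun x : NoTradePoint P => x.D.sf x.p - x.p := by
  have hwidth : IsOrder 1 fun x : NoTradePoint P => x.p - x.D.pLow (1 + x.εu) :=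
    ((isOrder_p_sub hP).sub (isOrder_pLow_sub hP)).of_eq fun x => by ring
  have hsub (x : NoTradePoint P) : Icc (x.D.pLow (1 + x.εu)) x.p ⊆
      Icc (x.D.pLow (1 + x.εu)) (x.D.pHigh (1 + x.εd)) := Icc_subset_Icc_right x.mem.2
  have hmvt := (isOrder_derivWithin_sf_sub_one hP).image_sub
    (F := fun x p => x.D.sf p - p) hwidth (fun x => x.mem.1)
    (fun x p hp => (((x.sol.shadow_fraction.contDiff.differentiableOn one_ne_zero p
      (hsub x hp)).hasDerivWithinAt.sub (hasDerivWithinAt_id p _)).mono (hsub x)))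
    fun x p hp => ⟨{ x with p := p, mem := hsub x hp }, rfl, rfl⟩
  refine (hmvt.sub (isOrder_pLow_sub_qLow hP).mono).of_eq fun x => ?_
  rw [x.sol.shadow_fraction.bd_left]
  ring

/-- The position in the no-transaction region, normalized to be between `-1` and `1` in the
limit. -/
noncomputable def position (x : NoTradePoint P) : ℝ := (x.p - P.qM) / (P.widthCoeff * size x)

theorem position_mul (hP : P.Regular) (x : NoTradePoint P) :
    x.position * (P.widthCoeff * size x) = x.p - P.qM :=
  div_mul_cancel₀ _ (mul_pos hP.widthCoeff_pos (size_pos x)).ne'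

theorem isOrder_h3_position (hP : P.Regular) :
    IsOrder 0 fun x : NoTradePoint P => h3 x.position := by
  have hv : IsOrder 0 fun x : NoTradePoint P => x.position := by
    refine .cancel (k := 1) ((isOrder_p_sub hP).of_eq (position_mul hP)) ?_
    simpa only [pow_one] using (isBigO_refl size _).const_mul_right hP.widthCoeff_pos.ne'
  exact (((IsOrder.const 1).add hv).pow 2).mul ((IsOrder.const 2).sub hv)

/-- The relative shadow price. -/
noncomputable def price (x : NoTradePoint P) : ℝ := x.D.κ (x.D.sf x.p)

/-- The decrease of the logarithm of the relative shadow price from the left boundary. -/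
noncomputable def logDecrease (x : NoTradePoint P) : ℝ := Real.log (1 + x.εu) - Real.log x.price

theorem isOrder_logDecrease (hP : P.Regular) : IsOrder 3 fun x : NoTradePoint P => x.logDecrease :=
  isOrder_toReducedPoint hP ReducedPoint.isOrder_I

theorem isOrder_logDecrease_sub (hP : P.Regular) :
    IsOrder 4 fun x : NoTradePoint P => x.logDecrease - size x ^ 3 * h3 x.position / 4 := by
  have hcubic := isOrder_toReducedPoint hP (ReducedPoint.isOrder_I_sub_cubic_size hP)
  have hp := isOrder_p_sub hP
  have hq := isOrder_sf_sub_qM hP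
  have hd : IsOrder 1 fun x : NoTradePoint P => P.widthCoeff * size x :=
    IsOrder.size_self.const_mul P.widthCoeff
  have hs := isOrder_sf_sub hP
  refine (hcubic.add (((hs.mul (hd.pow 2)).sub ((hs.mul (((hq.pow 2).add (hq.mul hp)).add
    (hp.pow 2))).const_mul (1 / 3))).const_mul (P.weightM⁻¹ * P.R))).of_eq fun x => ?_
  have hI : (x.toReducedPoint hP).I (x.toReducedPoint hP).q = x.logDecrease := rfl
  have hdev : (x.toReducedPoint hP).dev =
      x.D.sf x.p - x.p + x.position * (P.widthCoeff * size x) := by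
    rw [position_mul hP, sub_add_sub_cancel]
    rfl
  have hsize : size (x.toReducedPoint hP) = size x := rfl
  have hsf : x.D.sf x.p - P.qM = x.D.sf x.p - x.p + x.position * (P.widthCoeff * size x) := hdev
  rw [hI, hsize, hdev, hsf, ← position_mul hP x, h3, cubic]
  linear_combination
    (size x ^ 3 * ((1 + x.position) ^ 2 * (2 - x.position)) / 4) * hP.mul_widthCoeff_cube

theorem price_eq (x : NoTradePoint P) : x.price = (1 + x.εu) * Real.exp (-x.logDecrease) := by
  have hprice : 0 < x.price := x.sol.shadow_price.pos _ (x.sol.shadow_fraction.mapsTo x.mem)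
  have hu : 0 < 1 + x.εu := by linarith [x.εu_pos]
  rw [logDecrease, neg_sub, Real.exp_sub, Real.exp_log hprice, Real.exp_log hu,
    mul_div_cancel₀ _ hu.ne']

theorem isOrder_price_sub (hP : P.Regular) :
    IsOrder 6 fun x : NoTradePoint P => x.price - 1 - (x.εu - x.logDecrease) := by
  have hI := isOrder_logDecrease hP
  have hexp : IsOrder 6 fun x : NoTradePoint P =>
      Real.exp (-x.logDecrease) - 1 - -x.logDecrease := by
    refine (hI.pow 2).of_abs_le 1 ?_
    filter_upwards [hI.tendsto_zero.abs.eventually_le_const (by rw [abs_zero]; exact one_pos)]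
      with x hx
    rw [one_mul, abs_of_nonneg (sq_nonneg x.logDecrease), ← neg_sq]
    exact Real.abs_exp_sub_one_sub_id_le (by rwa [abs_neg])
  refine ((((IsOrder.const 1).add isOrder_εu.mono).mul hexp).sub (isOrder_εu.mul hI)).of_eq
    fun x => ?_
  rw [price_eq]
  ring

theorem isOrder_rate_sub_mM (hP : P.Regular) :
    IsOrder 2 fun x : NoTradePoint P => x.D.n (x.D.sf x.p) - P.mM :=
  (isOrder_toReducedPoint hP (ReducedPoint.isOrder_rate_sub hP)).of_eq fun x => by
    rw [← rate_excess hP x.D.n]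
    rfl

theorem isOrder_rate_sub (hP : P.Regular) : IsOrder 4 fun x : NoTradePoint P =>
    x.D.n (x.D.sf x.p) - (P.mM + P.gap * P.R * (P.widthCoeff * size x) ^ 2 +
      (1 / P.S - 1) * (P.mM * P.qM) * (size x ^ 3 / 2 - x.logDecrease)) := by
  have hgap : P.gap * P.excessSlope = (1 / P.S - 1) * (P.mM * P.qM) := by
    have := hP.σ_pos.ne'
    have := hP.S_pos.ne'
    rw [Params.gap, Params.excessSlope]
    field_simp
  refine (isOrder_toReducedPoint hP (ReducedPoint.isOrder_rate_expansion hP)).of_eq fun x => ?_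
  rw [← hgap, ← rate_excess hP x.D.n]
  rfl

theorem isOrder_consumptionRate_sub (hP : P.Regular) : IsOrder 4 fun x : NoTradePoint P =>
    x.D.consumptionRate x.p - P.rateExpansion x.εu x.εd x.cost x.p := by
  have hn := isOrder_rate_sub_mM hP
  have hn0 : IsOrder 0 fun x : NoTradePoint P => x.D.n (x.D.sf x.p) :=
    (hn.mono.add (.const P.mM)).of_eq fun x => by ring
  have hprice := isOrder_price_sub hP
  have hprice1 : IsOrder 3 fun x : NoTradePoint P => x.price - 1 :=
    (hprice.mono.add (isOrder_εu.sub (isOrder_logDecrease hP))).of_eq fun x => by ring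
  have hprod : IsOrder 4 fun x : NoTradePoint P =>
      x.p * (x.price - 1) * x.D.n (x.D.sf x.p) - P.qM * P.mM * (x.εu - x.logDecrease) :=
    (((((isOrder_p_sub hP).mul hprice1).mul hn0).add
      ((hprice1.mul hn).mono.const_mul P.qM)).add (hprice.mono.const_mul (P.qM * P.mM))).of_eq
        fun x => by ring
  have hεε : IsOrder 4 fun x : NoTradePoint P => x.εu * x.εd := (isOrder_εu.mul isOrder_εd).mono
  have hεεh : IsOrder 4 fun x : NoTradePoint P => x.εu * x.εd * (1 - 1 / 2 * h3 x.position) :=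
    hεε.mul ((IsOrder.const 1).sub ((isOrder_h3_position hP).const_mul (1 / 2)))
  refine ((((isOrder_rate_sub hP).add hprod).sub
    ((isOrder_logDecrease_sub hP).const_mul (P.mM * P.qM / P.S))).add
    (((hεεh.const_mul (P.mM * P.qM / (2 * P.S))).sub (hεε.const_mul (P.mM * P.qM / 2))).add
      (isOrder_size_sq_sub.mono.const_mul (P.gap * P.R * P.widthCoeff ^ 2)))).of_eq fun x => ?_
  have hv : (x.p - P.qM) / (P.Delta ^ (1 / 3 : ℝ) * x.cost ^ (1 / 3 : ℝ)) = x.position := rfl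
  rw [Params.rateExpansion, hv, ← hP.widthCoeff_sq, ShadowData.consumptionRate, ← price, size_cube,
    cost_eq]
  have := hP.S_pos.ne'
  field_simp
  ring

end NoTradePoint

theorem Solvent.wealth_pos {γu γd x y φ : ℝ} (hu : 1 ≤ γu) (hd : 1 ≤ γd)
    (h : Solvent γu γd x y φ) : 0 < x + y * φ := by
  obtain ⟨hy, hpos⟩ := h
  rcases le_total 0 φ with hφ | hφ
  · rw [max_eq_left hφ, max_eq_right (neg_nonpos.2 hφ)] at hpos
    have : 1 / γd * (φ * y) ≤ φ * y :=
      mul_le_of_le_one_left (by positivity) ((div_le_one (one_pos.trans_le hd)).2 hd)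
    linarith
  · rw [max_eq_right hφ, max_eq_left (neg_nonneg.2 hφ)] at hpos
    have : -φ * y ≤ γu * (-φ * y) :=
      le_mul_of_one_le_left (mul_nonneg (neg_nonneg.2 hφ) hy.le) hu
    linarith

theorem ShadowData.consumption_eq (D : ShadowData) {x y φ : ℝ} (hw : x + y * φ ≠ 0) (t : ℝ) :
    D.consumption t x y φ = (x + y * φ) * D.consumptionRate (frac x y φ) := by
  have hfrac : (x + y * φ) * frac x y φ = y * φ := mul_div_cancel₀ _ hw
  rw [consumption, consumptionRate]
  linear_combination -(D.κ (D.sf (frac x y φ)) - 1) * D.n (D.sf (frac x y φ)) * hfrac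

theorem exists_consumption_expansion {P : Params} (hP : P.Regular) :
    ∃ ε₀ : ℝ, 0 < ε₀ ∧ ∃ K : ℝ, ∀ εu εd : ℝ, 0 < εu → εu < ε₀ → 0 < εd → εd < ε₀ →
      ∀ D : ShadowData, D.Solves P (1 + εu) (1 + εd) → ∀ t x y φ : ℝ,
        Solvent (1 + εu) (1 + εd) x y φ →
        frac x y φ ∈ Icc (D.pLow (1 + εu)) (D.pHigh (1 + εd)) →
        |D.consumption t x y φ - (x + y * φ) *
            P.rateExpansion εu εd ((1 + εu) * (1 + εd) - 1) (frac x y φ)|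
          ≤ K * (x + y * φ) * ((1 + εu) * (1 + εd) - 1) ^ (4 / 3 : ℝ) := by
  obtain ⟨C, -, δ, hδ, hbound⟩ := (NoTradePoint.isOrder_consumptionRate_sub hP).exists_bound
  refine ⟨min 1 (δ ^ 3 / 3), by positivity, C,
    fun εu εd hu hu' hd hd' D hD t x y φ hs hp => ?_⟩
  obtain ⟨hu1, huδ⟩ := lt_min_iff.1 hu'
  obtain ⟨-, hdδ⟩ := lt_min_iff.1 hd'
  let z : NoTradePoint P := ⟨D, εu, εd, hu, hd, hD, frac x y φ, hp⟩
  have hsize : size z < δ := by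
    refine lt_of_pow_lt_pow_left₀ 3 hδ.le ?_
    rw [z.size_cube, z.cost_eq]
    change εu + εd + εu * εd < δ ^ 3
    nlinarith
  have hw := hs.wealth_pos (by linarith) (by linarith)
  rw [D.consumption_eq hw.ne', ← mul_sub, abs_mul, abs_of_pos hw, mul_comm C, mul_assoc]
  refine mul_le_mul_of_nonneg_left ((hbound z hsize).trans_eq ?_) hw.le
  rw [z.size_pow_eq]
  rfl

theorem Params.Regular.mul_rateExpansion {P : Params} (hP : P.Regular) (hm : P.mM ≠ 0)
    (w εu εd ε p : ℝ) :
    w * P.rateExpansion εu εd ε p = w * P.mM *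
      (1 + P.R * (1 - P.S) / P.S * (P.σ ^ 2 / (2 * P.mM))
          * P.Delta ^ (2 / 3 : ℝ) * (εu + εd) ^ (2 / 3 : ℝ)
        + P.qM / (2 * P.S)
          * (1 - 1 / 2 * h3 ((p - P.qM) / (P.Delta ^ (1 / 3 : ℝ) * ε ^ (1 / 3 : ℝ)))) * (εu + εd)
        + P.qM / 2 * (εu - εd)) := by
  have := hP.S_pos.ne'
  rw [Params.rateExpansion, Params.gap]
  field_simp
  ring

theorem Params.rateExpansion_of_mM_eq_zero {P : Params} (hm : P.mM = 0) (εu εd ε p : ℝ) :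
    P.rateExpansion εu εd ε p = P.R * (1 - P.S) / P.S * (P.σ ^ 2 / 2)
      * P.Delta ^ (2 / 3 : ℝ) * (εu + εd) ^ (2 / 3 : ℝ) := by
  rw [Params.rateExpansion, Params.gap, hm]
  ring

/-! ### Excursions of solutions of scalar equations -/

/-- `t ↦ α (z, t)` solves `y' = f (t, y)`, `y c = z` on `[c - τ, c + τ]` for `z ∈ s`, depends
continuously on `(z, t)`, and its graph stays in `U`. -/
structure IsFlowOn {E : Type*} [NormedAddCommGroup E] [NormedSpace ℝ E] (f : ℝ × E → E)
    (U : Set (ℝ × E)) (c τ : ℝ) (s : Set E) (α : E × ℝ → E) : Prop where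
  initial : ∀ z ∈ s, α (z, c) = z
  hasDerivWithinAt : ∀ z ∈ s, ∀ t ∈ Icc (c - τ) (c + τ),
    HasDerivWithinAt (fun t => α (z, t)) (f (t, α (z, t))) (Icc (c - τ) (c + τ)) t
  mem : ∀ z ∈ s, ∀ t ∈ Icc (c - τ) (c + τ), (t, α (z, t)) ∈ U
  continuousOn : ContinuousOn α (s ×ˢ Icc (c - τ) (c + τ))

theorem sub_eq_sub_of_hasDerivWithinAt_one {u : ℝ → ℝ} {s : Set ℝ} (hs : Convex ℝ s)
    (hu : ∀ t ∈ s, HasDerivWithinAt u 1 s t) {c t : ℝ} (hc : c ∈ s) (ht : t ∈ s) :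
    u t - u c = t - c := by
  have hd : ∀ t ∈ s, HasDerivWithinAt (fun t => u t - t) 0 s t := fun t ht =>
    ((hu t ht).sub (hasDerivWithinAt_id t s)).congr_deriv (sub_self 1)
  have := hs.norm_image_sub_le_of_norm_hasDerivWithin_le (C := 0) hd
    (fun _ _ => norm_zero.le) hc ht
  rw [zero_mul, norm_le_zero_iff] at this
  linarith

theorem exists_isFlowOn {E : Type*} [NormedAddCommGroup E] [NormedSpace ℝ E] [CompleteSpace E]
    {f : ℝ × E → E} {c : ℝ} {z₀ : E} (hf : ContDiffAt ℝ 1 f (c, z₀)) {U : Set (ℝ × E)}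
    (hU : U ∈ 𝓝 (c, z₀)) :
    ∃ τ > 0, ∃ α : E × ℝ → E, IsFlowOn f U c τ (Metric.closedBall z₀ τ) α := by
  -- the autonomous system with the time as an additional unknown
  obtain ⟨T, hT, _, r, _, _, hr, hPL⟩ := IsPicardLindelof.of_contDiffAt_one
    (contDiffAt_const.prodMk hf : ContDiffAt ℝ 1 (fun y => ((1 : ℝ), f y)) (c, z₀))
  obtain ⟨β, hβ, hβc⟩ := (hPL c).exists_forall_mem_closedBall_eq_hasDerivWithinAt_continuousOn
  dsimp only at hβ
  have hball {z : E} : (c, z) ∈ Metric.closedBall (c, z₀) r ↔ z ∈ Metric.closedBall z₀ r := by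
    simp [Prod.dist_eq]
  have htime {z : E} (hz : z ∈ Metric.closedBall z₀ r) {t : ℝ} (ht : t ∈ Icc (c - T) (c + T)) :
      (β ((c, z), t)).1 = t := by
    have := sub_eq_sub_of_hasDerivWithinAt_one (convex_Icc (c - T) (c + T))
      (fun t ht => hasFDerivAt_fst.comp_hasDerivWithinAt t ((hβ _ (hball.2 hz)).2 t ht))
      (⟨by linarith, by linarith⟩ : c ∈ Icc (c - T) (c + T)) ht
    simpa only [Function.comp_apply, (hβ _ (hball.2 hz)).1, sub_left_inj] using this
  have hcont : ContinuousOn (fun y : E × ℝ => β ((c, y.1), y.2))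
      (Metric.closedBall z₀ r ×ˢ Icc (c - T) (c + T)) :=
    hβc.comp (by fun_prop) fun y hy => mk_mem_prod (hball.2 hy.1) hy.2
  have hdom : Metric.closedBall z₀ r ×ˢ Icc (c - T) (c + T) ∈ 𝓝 (z₀, c) :=
    prod_mem_nhds (Metric.closedBall_mem_nhds _ hr) (Icc_mem_nhds (by linarith) (by linarith))
  have hz₀ : z₀ ∈ Metric.closedBall z₀ r := Metric.mem_closedBall_self r.2
  have hconf : {y : E × ℝ | β ((c, y.1), y.2) ∈ U} ∈ 𝓝 (z₀, c) :=
    (hcont.continuousAt hdom).preimage_mem_nhds (by rwa [(hβ _ (hball.2 hz₀)).1])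
  obtain ⟨τ, hτ, hsub⟩ := Metric.nhds_basis_closedBall.mem_iff.1 (inter_mem hdom hconf)
  rw [← closedBall_prod_same, Real.closedBall_eq_Icc] at hsub
  have hIcc : Icc (c - τ) (c + τ) ⊆ Icc (c - T) (c + T) := fun t ht =>
    (hsub (mk_mem_prod (Metric.mem_closedBall_self hτ.le) ht)).1.2
  have hz {z : E} (hz : z ∈ Metric.closedBall z₀ τ) : z ∈ Metric.closedBall z₀ r :=
    (hsub (mk_mem_prod hz ⟨by linarith, by linarith⟩ : (z, c) ∈ _ ×ˢ Icc (c - τ) (c + τ))).1.1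
  refine ⟨τ, hτ, fun y => (β ((c, y.1), y.2)).2, fun z hzτ => ?_, fun z hzτ t ht => ?_,
    fun z hzτ t ht => ?_, (hcont.mono fun y hy => (hsub hy).1).snd⟩
  · rw [(hβ _ (hball.2 (hz hzτ))).1]
  · have hd := hasFDerivAt_snd.comp_hasDerivWithinAt t
      (((hβ _ (hball.2 (hz hzτ))).2 t (hIcc ht)).mono hIcc)
    exact hd.congr_deriv (congrArg f (Prod.ext (htime (hz hzτ) (hIcc ht)) rfl))
  · have hmem : β ((c, z), t) ∈ U := (hsub (mk_mem_prod hzτ ht)).2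
    rwa [← Prod.mk.eta (p := β ((c, z), t)), htime (hz hzτ) (hIcc ht)] at hmem

theorem continuousOn_intervalIntegral {X : Type*} [TopologicalSpace X] {F : X × ℝ → ℝ}
    {s : Set X} {a b : ℝ} (hab : a ≤ b) (hF : ContinuousOn F (s ×ˢ Icc a b)) :
    ContinuousOn (fun x => ∫ t in a..b, F (x, t)) s := by
  rw [continuousOn_iff_continuous_domRestrict]
  have hext : Continuous fun y : s × ℝ => F (y.1, projIcc a b hab y.2) :=
    hF.comp_continuous (by fun_prop) fun y => ⟨y.1.2, (projIcc a b hab y.2).2⟩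
  refine (intervalIntegral.continuous_parametric_intervalIntegral_of_continuous'
    (μ := MeasureTheory.volume) (f := fun (x : s) t => F (x, projIcc a b hab t)) hext a b).congr
      fun x => intervalIntegral.integral_congr fun t ht => ?_
  rw [uIcc_of_le hab] at ht
  simp only [projIcc_of_mem hab ht]

theorem integral_max_zero_mul_eq {g w : ℝ → ℝ} {a b l r : ℝ} (hal : a ≤ l) (hlr : l ≤ r)
    (hrb : r ≤ b) (hin : ∀ t ∈ Icc l r, 0 ≤ g t) (hout : ∀ t ∈ Icc a b, t ∉ Icc l r → g t ≤ 0) :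
    ∫ t in a..b, max (g t) 0 * w t = ∫ t in l..r, g t * w t := by
  rw [intervalIntegral.integral_of_le (hal.trans (hlr.trans hrb)),
    intervalIntegral.integral_of_le hlr, ← MeasureTheory.integral_Icc_eq_integral_Ioc,
    ← MeasureTheory.integral_Icc_eq_integral_Ioc,
    MeasureTheory.setIntegral_eq_of_subset_of_forall_sdiff_eq_zero measurableSet_Icc
      (Icc_subset_Icc hal hrb) fun t ht => ?_]
  · refine MeasureTheory.setIntegral_congr_fun measurableSet_Icc fun t ht => ?_
    simp only [max_eq_left (hin t ht)]
  · rw [max_eq_right (hout t ht.1 ht.2), zero_mul]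

/-- `g * E` increases up to `c` and decreases after it, for some positive factor `E`. -/
def UnimodalUpToFactor (a c b : ℝ) (g : ℝ → ℝ) : Prop :=
  ∃ E : ℝ → ℝ, (∀ t, 0 < E t) ∧ StrictMonoOn (fun t => g t * E t) (Icc a c) ∧
    StrictAntiOn (fun t => g t * E t) (Icc c b)

namespace UnimodalUpToFactor

variable {a c b : ℝ} {g : ℝ → ℝ}

theorem pos_of_nonneg_left (h : UnimodalUpToFactor a c b g) {s t : ℝ} (hs : s ∈ Icc a c)
    (ht : t ∈ Icc a c) (hst : s < t) (h0 : 0 ≤ g s) : 0 < g t := by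
  obtain ⟨E, hE, hmono, -⟩ := h
  exact pos_of_mul_pos_left ((mul_nonneg h0 (hE s).le).trans_lt (hmono hs ht hst)) (hE t).le

theorem pos_of_nonneg_right (h : UnimodalUpToFactor a c b g) {s t : ℝ} (hs : s ∈ Icc c b)
    (ht : t ∈ Icc c b) (hst : s < t) (h0 : 0 ≤ g t) : 0 < g s := by
  obtain ⟨E, hE, -, hanti⟩ := h
  exact pos_of_mul_pos_left ((mul_nonneg h0 (hE t).le).trans_lt (hanti hs ht hst)) (hE s).le

theorem neg_of_eq_zero (h : UnimodalUpToFactor a c b g) (hc : g c = 0) {t : ℝ}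
    (ht : t ∈ Icc a b) (htc : t ≠ c) : g t < 0 := by
  by_contra! h0
  rcases htc.lt_or_gt with htc | htc
  · exact (h.pos_of_nonneg_left ⟨ht.1, htc.le⟩ ⟨ht.1.trans htc.le, le_rfl⟩ htc h0).ne' hc
  · exact (h.pos_of_nonneg_right ⟨le_rfl, htc.le.trans ht.2⟩ ⟨htc.le, ht.2⟩ htc h0).ne' hc

theorem exists_zeros (h : UnimodalUpToFactor a c b g) (hg : ContinuousOn g (Icc a b))
    (hac : a ≤ c) (hcb : c ≤ b) (ha : g a ≤ 0) (hc : 0 < g c) (hb : g b ≤ 0) :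
    ∃ l ∈ Ico a c, ∃ r ∈ Ioc c b, g l = 0 ∧ g r = 0 ∧ (∀ t ∈ Ioo l r, 0 < g t) ∧
      ∀ t ∈ Icc a b, t ∉ Icc l r → g t ≤ 0 := by
  obtain ⟨l, hl, hgl⟩ := intermediate_value_Icc hac (hg.mono (Icc_subset_Icc_right hcb)) ⟨ha, hc.le⟩
  obtain ⟨r, hr, hgr⟩ := intermediate_value_Icc' hcb (hg.mono (Icc_subset_Icc_left hac)) ⟨hb, hc.le⟩
  have hlc : l < c := hl.2.lt_of_ne fun h => hc.ne' (h ▸ hgl)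
  have hcr : c < r := hr.1.lt_of_ne fun h => hc.ne' (h ▸ hgr)
  refine ⟨l, ⟨hl.1, hlc⟩, r, ⟨hcr, hr.2⟩, hgl, hgr, fun t ht => ?_, fun t ht hlr => ?_⟩
  · rcases le_total t c with htc | htc
    · exact h.pos_of_nonneg_left hl ⟨hl.1.trans ht.1.le, htc⟩ ht.1 hgl.ge
    · exact h.pos_of_nonneg_right ⟨htc, ht.2.le.trans hr.2⟩ hr ht.2 hgr.ge
  · by_contra! h0
    rcases lt_or_ge t l with htl | htl
    · exact (h.pos_of_nonneg_left ⟨ht.1, htl.le.trans hl.2⟩ hl htl h0.le).ne' hgl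
    · have hrt : r < t := not_le.1 fun h => hlr ⟨htl, h⟩
      exact (h.pos_of_nonneg_right hr ⟨hr.1.trans hrt.le, ht.2⟩ hrt h0.le).ne' hgr

end UnimodalUpToFactor

theorem unimodalUpToFactor_of_hasDerivWithinAt {a c b R : ℝ} (hR : 0 < R) (hc : c ∈ Icc a b)
    {g H : ℝ → ℝ} (hH : ContinuousOn H (Icc a b)) (hg : ∀ t ∈ Icc a b,
      HasDerivWithinAt g (-(2 * R * (t - c)) - g t * H t) (Icc a b) t) :
    UnimodalUpToFactor a c b g := by
  have hd : ∀ t ∈ Icc a b, HasDerivWithinAt (fun t => g t * Real.exp (∫ x in c..t, H x))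
      (-(2 * R * (t - c)) * Real.exp (∫ x in c..t, H x)) (Icc a b) t := fun t ht =>
    ((hg t ht).mul (hasDerivWithinAt_integral_Icc hH hc ht).exp).congr_deriv (by ring)
  have hleft : Icc a c ⊆ Icc a b := Icc_subset_Icc_right hc.2
  have hright : Icc c b ⊆ Icc a b := Icc_subset_Icc_left hc.1
  refine ⟨fun t => Real.exp (∫ x in c..t, H x), fun t => Real.exp_pos _,
    strictMonoOn_of_hasDerivWithinAt_pos (convex_Icc _ _)
      (fun t ht => ((hd t (hleft ht)).mono hleft).continuousWithinAt)
      (fun t ht => (hd t (hleft (interior_subset ht))).mono (interior_subset.trans hleft))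
      fun t ht => mul_pos ?_ (Real.exp_pos _),
    strictAntiOn_of_hasDerivWithinAt_neg (convex_Icc _ _)
      (fun t ht => ((hd t (hright ht)).mono hright).continuousWithinAt)
      (fun t ht => (hd t (hright (interior_subset ht))).mono (interior_subset.trans hright))
      fun t ht => mul_neg_of_neg_of_pos ?_ (Real.exp_pos _)⟩
  · rw [interior_Icc] at ht
    nlinarith [ht.2]
  · rw [interior_Icc] at ht
    nlinarith [ht.1]

/-- The field of the equation `y' = -2 R (t - c) - y H(t, y)`, whose forcing term pushes `y` up
before time `c` and down after it. -/
def humpField (R c : ℝ) (H : ℝ × ℝ → ℝ) (y : ℝ × ℝ) : ℝ := -(2 * R * (y.1 - c)) - y.2 * H y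

/-- `g` solves the equation of `humpField R c H` on `[a, b]`, with graph in `U`, and is positive
exactly between its zeros `a < c < b`. -/
structure IsExcursion (R c : ℝ) (H : ℝ × ℝ → ℝ) (U : Set (ℝ × ℝ)) (a b : ℝ) (g : ℝ → ℝ) : Prop where
  left_lt : a < c
  lt_right : c < b
  mem : ∀ t ∈ Icc a b, (t, g t) ∈ U
  hasDerivWithinAt : ∀ t ∈ Icc a b, HasDerivWithinAt g (humpField R c H (t, g t)) (Icc a b) t
  left_eq : g a = 0
  right_eq : g b = 0
  pos : ∀ t ∈ Ioo a b, 0 < g t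

namespace IsExcursion

variable {R c a b : ℝ} {H : ℝ × ℝ → ℝ} {U : Set (ℝ × ℝ)} {g : ℝ → ℝ}

theorem lt (h : IsExcursion R c H U a b g) : a < b := h.left_lt.trans h.lt_right

theorem left_mem (h : IsExcursion R c H U a b g) : a ∈ Icc a b := left_mem_Icc.2 h.lt.le

theorem right_mem (h : IsExcursion R c H U a b g) : b ∈ Icc a b := right_mem_Icc.2 h.lt.le

theorem nonneg (h : IsExcursion R c H U a b g) {t : ℝ} (ht : t ∈ Icc a b) : 0 ≤ g t := by
  rcases ht.1.eq_or_lt with rfl | hat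
  · exact h.left_eq.ge
  rcases ht.2.eq_or_lt with rfl | htb
  · exact h.right_eq.ge
  · exact (h.pos t ⟨hat, htb⟩).le

theorem continuousOn (h : IsExcursion R c H U a b g) : ContinuousOn g (Icc a b) := fun t ht =>
  (h.hasDerivWithinAt t ht).continuousWithinAt

theorem continuousOn_comp_graph (h : IsExcursion R c H U a b g) {w : ℝ × ℝ → ℝ}
    (hw : ContinuousOn w U) : ContinuousOn (fun t => w (t, g t)) (Icc a b) :=
  hw.comp (continuousOn_id.prodMk h.continuousOn) h.mem

end IsExcursion

namespace IsFlowOn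

variable {R c τ : ℝ} {H : ℝ × ℝ → ℝ} {U : Set (ℝ × ℝ)} {s : Set ℝ} {α : ℝ × ℝ → ℝ}

theorem continuousOn_graph (h : IsFlowOn (humpField R c H) U c τ s α) :
    ContinuousOn (fun y : ℝ × ℝ => (y.2, α y)) (s ×ˢ Icc (c - τ) (c + τ)) :=
  continuousOn_snd.prodMk h.continuousOn

theorem unimodalUpToFactor (h : IsFlowOn (humpField R c H) U c τ s α) (hR : 0 < R) (hτ : 0 < τ)
    (hH : ContinuousOn H U) {z : ℝ} (hz : z ∈ s) :
    UnimodalUpToFactor (c - τ) c (c + τ) fun t => α (z, t) :=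
  unimodalUpToFactor_of_hasDerivWithinAt (H := fun t => H (t, α (z, t))) hR
    ⟨by linarith, by linarith⟩
    (hH.comp (h.continuousOn_graph.comp (by fun_prop) fun _ ht => mk_mem_prod hz ht) (h.mem z hz))
    (h.hasDerivWithinAt z hz)

theorem exists_isExcursion (h : IsFlowOn (humpField R c H) U c τ s α) (hR : 0 < R) (hτ : 0 < τ)
    (hH : ContinuousOn H U) (w : ℝ × ℝ → ℝ) {z : ℝ} (hz : z ∈ s) (hz0 : 0 < z)
    (hl : α (z, c - τ) ≤ 0) (hr : α (z, c + τ) ≤ 0) :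
    ∃ a b, IsExcursion R c H U a b (fun t => α (z, t)) ∧
      ∫ t in (c - τ)..(c + τ), max (α (z, t)) 0 * w (t, α (z, t)) =
        ∫ t in a..b, α (z, t) * w (t, α (z, t)) := by
  obtain ⟨a, ha, b, hb, hga, hgb, hpos, hout⟩ := (h.unimodalUpToFactor hR hτ hH hz).exists_zeros
    (fun t ht => (h.hasDerivWithinAt z hz t ht).continuousWithinAt) (by linarith) (by linarith)
    hl (by rwa [h.initial z hz]) hr
  have hsub : Icc a b ⊆ Icc (c - τ) (c + τ) := Icc_subset_Icc ha.1 hb.2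
  have hexc : IsExcursion R c H U a b (fun t => α (z, t)) :=
    ⟨ha.2, hb.1, fun t ht => h.mem z hz t (hsub ht),
      fun t ht => (h.hasDerivWithinAt z hz t (hsub ht)).mono hsub, hga, hgb, hpos⟩
  exact ⟨a, b, hexc, integral_max_zero_mul_eq ha.1 hexc.lt.le hb.2 (fun t => hexc.nonneg) hout⟩

theorem exists_pos_forall_endpoints_neg (h : IsFlowOn (humpField R c H) U c τ s α) (hR : 0 < R)
    (hτ : 0 < τ) (hH : ContinuousOn H U) (hs : s ∈ 𝓝 0) :
    ∃ z₁ > 0, ∀ z ∈ Icc 0 z₁, z ∈ s ∧ α (z, c - τ) < 0 ∧ α (z, c + τ) < 0 := by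
  have h0 := mem_of_mem_nhds hs
  have hneg : ∀ t ∈ Icc (c - τ) (c + τ), t ≠ c → ∀ᶠ z in 𝓝 (0 : ℝ), α (z, t) < 0 :=
    fun t ht htc => by
      have hcont : ContinuousOn (fun z => α (z, t)) s :=
        h.continuousOn.comp (by fun_prop) fun z hz => mk_mem_prod hz ht
      exact (hcont.continuousAt hs).eventually (gt_mem_nhds
        ((h.unimodalUpToFactor hR hτ hH h0).neg_of_eq_zero (h.initial 0 h0) ht htc))
  obtain ⟨z₁, hz₁, hsub⟩ := Metric.nhds_basis_closedBall.eventually_iff.1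
    ((eventually_mem_set.2 hs).and ((hneg (c - τ) ⟨le_rfl, by linarith⟩ (by linarith)).and
      (hneg (c + τ) ⟨by linarith, le_rfl⟩ (by linarith))))
  refine ⟨z₁, hz₁, fun z hz => hsub ?_⟩
  rw [Real.closedBall_eq_Icc]
  exact ⟨by linarith [hz.1], by linarith [hz.2]⟩

end IsFlowOn

theorem exists_isExcursion_integral_eq {R c : ℝ} (hR : 0 < R) {H w : ℝ × ℝ → ℝ} {U : Set (ℝ × ℝ)}
    (hH : ContDiffAt ℝ 1 H (c, 0)) (hU : U ∈ 𝓝 (c, 0)) (hHc : ContinuousOn H U)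
    (hw : ContinuousOn w U) (hw0 : ∀ y ∈ U, 0 < w y) :
    ∃ L₀ > 0, ∀ L, 0 < L → L < L₀ → ∃ a b g, IsExcursion R c H U a b g ∧
      ∫ t in a..b, g t * w (t, g t) = L := by
  obtain ⟨τ, hτ, α, hα⟩ := exists_isFlowOn (f := humpField R c H)
    (by unfold humpField; fun_prop) hU
  have hball := Metric.closedBall_mem_nhds (0 : ℝ) hτ
  obtain ⟨z₁, hz₁, hends⟩ := hα.exists_pos_forall_endpoints_neg hR hτ hHc hball
  have hle : c - τ ≤ c + τ := by linarith
  have hcτ : c ∈ Icc (c - τ) (c + τ) := ⟨by linarith, by linarith⟩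
  set Φ : ℝ → ℝ := fun z => ∫ t in (c - τ)..(c + τ), max (α (z, t)) 0 * w (t, α (z, t))
  have hF : ContinuousOn (fun y : ℝ × ℝ => max (α y) 0 * w (y.2, α y))
      (Metric.closedBall 0 τ ×ˢ Icc (c - τ) (c + τ)) :=
    (hα.continuousOn.sup continuousOn_const).mul
      (hw.comp hα.continuousOn_graph fun y hy => hα.mem _ hy.1 _ hy.2)
  have hΦc : ContinuousOn Φ (Icc 0 z₁) :=
    (continuousOn_intervalIntegral hle hF).mono fun z hz => (hends z hz).1
  have hΦ0 : Φ 0 = 0 := by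
    have h0 := mem_of_mem_nhds hball
    have hnonpos : ∀ t ∈ Icc (c - τ) (c + τ), α (0, t) ≤ 0 := fun t ht => by
      rcases eq_or_ne t c with rfl | htc
      · exact (hα.initial 0 h0).le
      · exact ((hα.unimodalUpToFactor hR hτ hHc h0).neg_of_eq_zero (hα.initial 0 h0) ht htc).le
    refine (intervalIntegral.integral_congr fun t ht => ?_).trans intervalIntegral.integral_zero
    simp only [max_eq_right (hnonpos t (uIcc_of_le hle ▸ ht)), zero_mul]
  have hΦ1 : 0 < Φ z₁ := by
    have hz := (hends z₁ (right_mem_Icc.2 hz₁.le)).1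
    refine intervalIntegral.integral_pos (by linarith)
      (hF.comp (by fun_prop) fun t ht => mk_mem_prod hz ht) (fun t ht => ?_) ⟨c, hcτ, ?_⟩
    · exact mul_nonneg (le_max_right _ _) (hw0 _ (hα.mem z₁ hz t (Ioc_subset_Icc_self ht))).le
    · exact mul_pos (by simpa [hα.initial z₁ hz] using hz₁) (hw0 _ (hα.mem z₁ hz c hcτ))
  refine ⟨Φ z₁, hΦ1, fun L hL hL₁ => ?_⟩
  obtain ⟨z, hz, rfl⟩ := intermediate_value_Icc hz₁.le hΦc ⟨hΦ0.trans_le hL.le, hL₁.le⟩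
  obtain ⟨hzτ, hl, hr⟩ := hends z hz
  have hz0 : 0 < z := hz.1.lt_of_ne fun h => hL.ne' (h ▸ hΦ0)
  obtain ⟨a, b, hexc, hint⟩ := hα.exists_isExcursion hR hτ hHc w hzτ hz0 hl.le hr.le
  exact ⟨a, b, _, hexc, hint.symm⟩

/-! ### Existence of the shadow data -/

/-- The coefficient of `g` in the equation for the scaled excess `g`, as a function of `(q, g)`. -/
noncomputable def Params.damping (P : Params) (y : ℝ × ℝ) : ℝ :=
  2 / P.σ ^ 2 * (P.mM + P.gap * (P.R * (y.1 - P.qM) ^ 2 + y.2)) /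
    ((1 - y.1) * (y.1 * (1 - y.1) - y.2))

/-- The factor between the scaled excess `g` and the rate of decrease of the logarithm of the
relative shadow price, as a function of `(q, g)`. -/
noncomputable def slopeWeight (y : ℝ × ℝ) : ℝ := 1 / (y.1 * (1 - y.1) * (y.1 * (1 - y.1) - y.2))

/-- The pairs `(q, g)` on the correct side of the singular set `q * (1 - q) * (q * (1 - q) - g) = 0`
for which `q` satisfies the bounds of the free boundary problem and the consumption rate is
positive. -/
structure Params.Admissible (P : Params) (y : ℝ × ℝ) : Prop where
  pos : 0 < P.qM → 0 < y.1
  lt_one : P.qM < 1 → y.1 < 1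
  lt_big : 1 < P.qM → y.1 < 2 * P.qM - 1
  neg : P.qM < 0 → 2 * P.qM < y.1 ∧ y.1 < 0
  weight_pos : 0 < y.1 * (1 - y.1) * (y.1 * (1 - y.1) - y.2)
  rate_pos : 0 < P.mM → 0 < P.mM + P.gap * (P.R * (y.1 - P.qM) ^ 2 + y.2)

namespace Params

variable {P : Params}

namespace Admissible

variable {y : ℝ × ℝ}

theorem ne_zero (h : P.Admissible y) : y.1 ≠ 0 :=
  left_ne_zero_of_mul (left_ne_zero_of_mul h.weight_pos.ne')

theorem one_sub_ne_zero (h : P.Admissible y) : 1 - y.1 ≠ 0 :=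
  right_ne_zero_of_mul (left_ne_zero_of_mul h.weight_pos.ne')

theorem sub_ne_zero (h : P.Admissible y) : y.1 * (1 - y.1) - y.2 ≠ 0 :=
  right_ne_zero_of_mul h.weight_pos.ne'

theorem slopeWeight_pos (h : P.Admissible y) : 0 < slopeWeight y := one_div_pos.2 h.weight_pos

theorem qM_mul_pos (h : P.Admissible y) (hP : P.Regular) : 0 < P.qM * y.1 := by
  rcases hP.qM_ne_zero.lt_or_gt with h0 | h0
  · exact mul_pos_of_neg_of_neg h0 (h.neg h0).2
  · exact mul_pos h0 (h.pos h0)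

end Admissible

theorem continuousOn_damping : ContinuousOn P.damping {y | P.Admissible y} := by
  unfold damping
  exact ContinuousOn.div (by fun_prop) (by fun_prop) fun y hy =>
    mul_ne_zero hy.one_sub_ne_zero hy.sub_ne_zero

theorem continuousOn_slopeWeight : ContinuousOn slopeWeight {y | P.Admissible y} := by
  unfold slopeWeight
  exact ContinuousOn.div (by fun_prop) (by fun_prop) fun y hy => hy.weight_pos.ne'

namespace Regular

theorem qM_mul_one_sub_ne_zero (hP : P.Regular) : P.qM * (1 - P.qM) ≠ 0 :=
  mul_ne_zero hP.qM_ne_zero (sub_ne_zero.2 hP.qM_ne_one.symm)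

theorem contDiffAt_damping (hP : P.Regular) : ContDiffAt ℝ 1 P.damping (P.qM, 0) := by
  unfold damping
  refine ContDiffAt.div (by fun_prop) (by fun_prop) ?_
  rw [sub_zero]
  exact mul_ne_zero (right_ne_zero_of_mul hP.qM_mul_one_sub_ne_zero) hP.qM_mul_one_sub_ne_zero

theorem admissible_mem_nhds (hP : P.Regular) : {y | P.Admissible y} ∈ 𝓝 ((P.qM, 0) : ℝ × ℝ) := by
  have hq : Tendsto (fun y : ℝ × ℝ => y.1) (𝓝 (P.qM, 0)) (𝓝 P.qM) := continuousAt_fst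
  have hweight : ∀ᶠ y : ℝ × ℝ in 𝓝 (P.qM, 0), 0 < y.1 * (1 - y.1) * (y.1 * (1 - y.1) - y.2) := by
    have hcont : ContinuousAt (fun y : ℝ × ℝ => y.1 * (1 - y.1) * (y.1 * (1 - y.1) - y.2))
        (P.qM, 0) := by fun_prop
    refine hcont.eventually (lt_mem_nhds ?_)
    simp only [sub_zero]
    exact mul_self_pos.2 hP.qM_mul_one_sub_ne_zero
  have hrate : ∀ᶠ y : ℝ × ℝ in 𝓝 (P.qM, 0),
      0 < P.mM → 0 < P.mM + P.gap * (P.R * (y.1 - P.qM) ^ 2 + y.2) :=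
    eventually_imp_distrib_left.2 fun h => by
      have hcont : ContinuousAt (fun y : ℝ × ℝ =>
          P.mM + P.gap * (P.R * (y.1 - P.qM) ^ 2 + y.2)) (P.qM, 0) := by fun_prop
      exact hcont.eventually (lt_mem_nhds (by simpa using h))
  filter_upwards [hweight, hrate,
    eventually_imp_distrib_left.2 fun h : 0 < P.qM => hq.eventually (lt_mem_nhds h),
    eventually_imp_distrib_left.2 fun h : P.qM < 1 => hq.eventually (gt_mem_nhds h),
    eventually_imp_distrib_left.2 fun h : 1 < P.qM => hq.eventually
      (gt_mem_nhds (by linarith : P.qM < 2 * P.qM - 1)),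
    eventually_imp_distrib_left.2 fun h : P.qM < 0 =>
      (hq.eventually (lt_mem_nhds (by linarith : 2 * P.qM < P.qM))).and
        (hq.eventually (gt_mem_nhds h))] with y hweight hrate hpos hlt hbig hneg
  exact ⟨hpos, hlt, hbig, hneg, hweight, hrate⟩

end Regular

/-- `g` solves the equation for the scaled excess, and its positive part lives on the interval
`[a, b]`, which contains the Merton ratio. -/
abbrev IsReducedExcursion (P : Params) (a b : ℝ) (g : ℝ → ℝ) : Prop :=
  IsExcursion P.R P.qM P.damping {y | P.Admissible y} a b g

theorem Regular.exists_isReducedExcursion (hP : P.Regular) : ∃ L₀ > 0, ∀ L, 0 < L → L < L₀ →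
    ∃ a b g, P.IsReducedExcursion a b g ∧ ∫ q in a..b, g q * slopeWeight (q, g q) = L :=
  exists_isExcursion_integral_eq hP.R_pos hP.contDiffAt_damping hP.admissible_mem_nhds
    continuousOn_damping continuousOn_slopeWeight fun _ hy => hy.slopeWeight_pos

end Params

/-- The integrand of the round-trip cost: minus the logarithmic derivative of the relative shadow
price. -/
noncomputable def shadowSlope (P : Params) (n : ℝ → ℝ) (q : ℝ) : ℝ :=
  -(1 / (q * (1 - q))) * ((P.m q - n q) / (P.ell q - n q))

section shadowSlope

variable {P : Params}

theorem shadowSlope_eq (hP : P.Regular) (n : ℝ → ℝ) (q : ℝ) : shadowSlope P n q =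
    excess P n q / (q * (1 - q) * (q * (1 - q) - excess P n q)) := by
  rw [shadowSlope, div_ell_sub_eq hP, neg_mul_neg, div_mul_div_comm, one_mul]

theorem excess_rate (hP : P.Regular) (g : ℝ → ℝ) : excess P (P.rate g) = g := by
  funext q
  rw [excess, Params.rate, Params.m_eq hP.σ_pos.ne' hP.R_pos.ne', div_eq_iff hP.gap_ne]
  ring

theorem shadowSlope_rate (hP : P.Regular) (g : ℝ → ℝ) (q : ℝ) :
    shadowSlope P (P.rate g) q = g q * slopeWeight (q, g q) := by
  rw [shadowSlope_eq hP, excess_rate hP, slopeWeight, mul_one_div]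

theorem Params.Regular.rate_eq_m (hP : P.Regular) {g : ℝ → ℝ} {q : ℝ} (h0 : g q = 0) :
    P.rate g q = P.m q := by
  rw [Params.rate, Params.m_eq hP.σ_pos.ne' hP.R_pos.ne', h0, add_zero, mul_assoc]

end shadowSlope

namespace Params.IsReducedExcursion

variable {P : Params} {a b q : ℝ} {g : ℝ → ℝ}

theorem one_notMem (h : P.IsReducedExcursion a b g) : 1 ∉ Icc a b := fun h1 =>
  (h.mem 1 h1).one_sub_ne_zero (sub_self 1)

theorem shadowSlope_nonneg (h : P.IsReducedExcursion a b g) (hP : P.Regular)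
    (hq : q ∈ Icc a b) : 0 ≤ shadowSlope P (P.rate g) q := by
  rw [shadowSlope_rate hP]
  exact mul_nonneg (h.nonneg hq) (h.mem q hq).slopeWeight_pos.le

theorem continuousOn_shadowSlope (h : P.IsReducedExcursion a b g) (hP : P.Regular) :
    ContinuousOn (shadowSlope P (P.rate g)) (Icc a b) := by
  rw [funext (shadowSlope_rate hP g)]
  exact h.continuousOn.mul (h.continuousOn_comp_graph continuousOn_slopeWeight)

theorem hasDerivWithinAt_rate (h : P.IsReducedExcursion a b g) (hP : P.Regular)
    (hq : q ∈ Icc a b) : HasDerivWithinAt (P.rate g)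
      (-(P.gap * (2 / P.σ ^ 2)) * (P.rate g q * q * shadowSlope P (P.rate g) q)) (Icc a b) q := by
  have hsq := ((((hasDerivAt_id q).sub_const P.qM).pow 2).const_mul P.R).hasDerivWithinAt
    (s := Icc a b)
  refine (((hsq.add (h.hasDerivWithinAt q hq)).const_mul P.gap).const_add P.mM).congr_deriv ?_
  have hq0 := (h.mem q hq).ne_zero
  have hdamping : P.damping (q, g q) =
      2 / P.σ ^ 2 * (P.rate g q * q * slopeWeight (q, g q)) := by
    dsimp only at hq0
    rw [slopeWeight, damping, ← rate]
    field_simp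
  rw [humpField, hdamping, shadowSlope_rate hP]
  simp only [id, Nat.cast_ofNat]
  ring

theorem continuousOn_rate (h : P.IsReducedExcursion a b g) (hP : P.Regular) :
    ContinuousOn (P.rate g) (Icc a b) := fun _ hq =>
  (h.hasDerivWithinAt_rate hP hq).continuousWithinAt

theorem rate_pos (h : P.IsReducedExcursion a b g) (hR : 0 < P.R)
    (hm : 0 < P.mM ∨ P.mM = 0 ∧ 0 < P.gap) (hq : q ∈ Icc a b) : 0 < P.rate g q := by
  rcases hm with hm | ⟨hm, hgap⟩
  · exact (h.mem q hq).rate_pos hm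
  rw [rate, hm, zero_add]
  refine mul_pos hgap ?_
  rcases eq_or_ne q P.qM with rfl | hne
  · exact add_pos_of_nonneg_of_pos (by positivity) (h.pos _ ⟨h.left_lt, h.lt_right⟩)
  · exact add_pos_of_pos_of_nonneg (mul_pos hR (by have := sub_ne_zero.2 hne; positivity))
      (h.nonneg hq)

theorem antitoneOn_rate (h : P.IsReducedExcursion a b g) (hP : P.Regular)
    (hpos : ∀ q ∈ Icc a b, 0 < P.rate g q) (hsign : ∀ q ∈ Icc a b, 0 ≤ P.gap * q) :
    AntitoneOn (P.rate g) (Icc a b) :=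
  antitoneOn_Icc_of_hasDerivWithinAt (fun q hq => h.hasDerivWithinAt_rate hP hq) fun q hq => by
    have := mul_nonneg (hsign q hq) (mul_nonneg (div_nonneg zero_le_two (sq_nonneg P.σ))
      (mul_nonneg (hpos q hq).le (h.shadowSlope_nonneg hP hq)))
    linarith

theorem monotoneOn_rate (h : P.IsReducedExcursion a b g) (hP : P.Regular)
    (hpos : ∀ q ∈ Icc a b, 0 < P.rate g q) (hsign : ∀ q ∈ Icc a b, P.gap * q ≤ 0) :
    MonotoneOn (P.rate g) (Icc a b) :=
  monotoneOn_Icc_of_hasDerivWithinAt (fun q hq => h.hasDerivWithinAt_rate hP hq) fun q hq => by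
    have := mul_nonneg (neg_nonneg.2 (hsign q hq))
      (mul_nonneg (div_nonneg zero_le_two (sq_nonneg P.σ))
        (mul_nonneg (hpos q hq).le (h.shadowSlope_nonneg hP hq)))
    linarith

theorem gap_mul_mul_pos (h : P.IsReducedExcursion a b g) (hP : P.Regular)
    (hsign : 0 < P.gap * (1 - P.R)) (hq : q ∈ Icc a b) :
    0 < P.gap * q * ((1 - P.R) * P.qM) := by
  linarith [mul_pos hsign ((h.mem q hq).qM_mul_pos hP)]

theorem derivWithin_rate (h : P.IsReducedExcursion a b g) (hP : P.Regular) (hq : q ∈ Icc a b) :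
    derivWithin (P.rate g) (Icc a b) q =
      (1 - P.S) / P.S * (P.rate g q / (1 - q)) *
        ((P.m q - P.rate g q) / (P.ell q - P.rate g q)) := by
  have hgap : (1 - P.S) / P.S = P.gap * (2 / P.σ ^ 2) := by
    have := hP.σ_pos.ne'
    rw [gap]
    field_simp
  have hq0 := (h.mem q hq).ne_zero
  have hq1 := (h.mem q hq).one_sub_ne_zero
  dsimp only at hq0 hq1
  rw [(h.hasDerivWithinAt_rate hP hq).derivWithin (uniqueDiffOn_Icc h.lt q hq), hgap, shadowSlope]
  field_simp

theorem derivWithin_rate_eq_zero (h : P.IsReducedExcursion a b g) (hP : P.Regular)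
    (hq : q ∈ Icc a b) (h0 : g q = 0) : derivWithin (P.rate g) (Icc a b) q = 0 := by
  rw [(h.hasDerivWithinAt_rate hP hq).derivWithin (uniqueDiffOn_Icc h.lt q hq),
    shadowSlope_rate hP, h0, zero_mul, mul_zero, mul_zero]

theorem freeBoundary (h : P.IsReducedExcursion a b g) (hP : P.Regular)
    (hsign : 0 < P.gap * (1 - P.R)) (hm : 0 < P.mM ∨ P.mM = 0 ∧ 0 < P.gap) {ξ : ℝ} (hξ : 0 < ξ)
    (hint : ∫ q in a..b, g q * slopeWeight (q, g q) = Real.log ξ) :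
    FreeBoundary P ξ a b (P.rate g) := by
  have hpos : ∀ q ∈ Icc a b, 0 < P.rate g q := fun q hq => h.rate_pos hP.R_pos hm hq
  have ha := h.mem a h.left_mem
  have hb := h.mem b h.right_mem
  exact {
    loc_mid := fun h0 h1 => ⟨ha.pos h0, h.left_lt, h.lt_right, hb.lt_one h1⟩
    loc_one := fun h1 => absurd h1 hP.qM_ne_one
    loc_big := fun h1 => ⟨ha.pos (zero_lt_one.trans h1), h.left_lt, h.lt_right, hb.lt_big h1⟩
    loc_neg := fun h0 => ⟨(ha.neg h0).1, h.left_lt, h.lt_right, (hb.neg h0).2⟩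
    contDiff := contDiffOn_one_Icc_of_hasDerivWithinAt h.lt
      (fun q hq => h.hasDerivWithinAt_rate hP hq)
      (continuousOn_const.mul
        (((h.continuousOn_rate hP).mul continuousOn_id).mul (h.continuousOn_shadowSlope hP)))
    pos := hpos
    ne_ell := fun q hq _ heq => by
      have := gap_mul_sub_excess hP (P.rate g) q
      rw [heq, sub_self, excess_rate hP] at this
      exact mul_ne_zero hP.gap_ne (h.mem q hq).sub_ne_zero this
    anti := fun hR => h.antitoneOn_rate hP hpos fun q hq =>
      (pos_of_mul_pos_left (h.gap_mul_mul_pos hP hsign hq) hR.le).le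
    mono := fun hR => h.monotoneOn_rate hP hpos fun q hq =>
      (neg_of_mul_pos_left (h.gap_mul_mul_pos hP hsign hq) hR.le).le
    ode := fun q hq _ => h.derivWithin_rate hP hq
    bd_left := hP.rate_eq_m h.left_eq
    bd_right := hP.rate_eq_m h.right_eq
    deriv_left := h.derivWithin_rate_eq_zero hP h.left_mem h.left_eq
    deriv_right := h.derivWithin_rate_eq_zero hP h.right_mem h.right_eq
    at_one := fun h1 => absurd h1 h.one_notMem
    integral_eq := by
      rw [← Real.exp_log hξ, ← hint]
      simp only [← shadowSlope_rate hP, shadowSlope] }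

end Params.IsReducedExcursion

/-- The relative shadow price with value `γ` at `a` and logarithmic derivative `-G`. -/
noncomputable def shadowPrice (γ a : ℝ) (G : ℝ → ℝ) (q : ℝ) : ℝ :=
  γ * Real.exp (-∫ t in a..q, G t)

theorem hasDerivWithinAt_shadowPrice (γ : ℝ) {a b : ℝ} {G : ℝ → ℝ} (hG : ContinuousOn G (Icc a b))
    {q : ℝ} (hq : q ∈ Icc a b) :
    HasDerivWithinAt (shadowPrice γ a G) (-(shadowPrice γ a G q * G q)) (Icc a b) q := by
  have hint := hasDerivWithinAt_integral_Icc hG (left_mem_Icc.2 (hq.1.trans hq.2)) hq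
  refine (hint.neg.exp.const_mul γ).congr_deriv ?_
  simp only [Pi.neg_apply, shadowPrice]
  ring

namespace FreeBoundary

variable {P : Params} {γu γd ξ a b : ℝ} {n : ℝ → ℝ}

theorem continuousOn_shadowSlope (h : FreeBoundary P ξ a b n) (hP : P.Regular)
    (h1 : 1 ∉ Icc a b) : ContinuousOn (shadowSlope P n) (Icc a b) := by
  rw [funext (shadowSlope_eq hP n)]
  exact h.continuousOn_excess.div
    (ContinuousOn.mul (by fun_prop) (ContinuousOn.sub (by fun_prop) h.continuousOn_excess))
    fun q hq => (h.weight_pos hP hq (ne_of_mem_of_not_mem hq h1)).ne'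

theorem shadowPrice_right (h : FreeBoundary P (γu * γd) a b n) (hu : γu ≠ 0) :
    shadowPrice γu a (shadowSlope P n) b = 1 / γd := by
  unfold shadowPrice shadowSlope
  rw [Real.exp_neg, ← h.integral_eq, ← div_eq_mul_inv, div_mul_cancel_left₀ hu, one_div]

theorem relShadowPrice (h : FreeBoundary P (γu * γd) a b n) (hP : P.Regular) (h1 : 1 ∉ Icc a b)
    (h0 : ∀ q ∈ Icc a b, 0 ≤ shadowSlope P n q) (hu : 0 < γu) :
    RelShadowPrice P γu γd a b n (shadowPrice γu a (shadowSlope P n)) := by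
  have hab := h.lt hP
  have hcont := h.continuousOn_shadowSlope hP h1
  have hpos (q : ℝ) : 0 < shadowPrice γu a (shadowSlope P n) q := mul_pos hu (Real.exp_pos _)
  have hderiv : ∀ q ∈ Icc a b, HasDerivWithinAt (shadowPrice γu a (shadowSlope P n))
      (-(shadowPrice γu a (shadowSlope P n) q * shadowSlope P n q)) (Icc a b) q :=
    fun q hq => hasDerivWithinAt_shadowPrice γu hcont hq
  have hderivWithin : ∀ q ∈ Icc a b, derivWithin (shadowPrice γu a (shadowSlope P n)) (Icc a b) q =
      -(shadowPrice γu a (shadowSlope P n) q * shadowSlope P n q) :=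
    fun q hq => (hderiv q hq).derivWithin (uniqueDiffOn_Icc hab q hq)
  have hzero : ∀ q ∈ Icc a b, excess P n q = 0 →
      derivWithin (shadowPrice γu a (shadowSlope P n)) (Icc a b) q = 0 := fun q hq h0 => by
    rw [hderivWithin q hq, shadowSlope_eq hP, h0, zero_div, mul_zero, neg_zero]
  exact {
    contDiff := contDiffOn_one_Icc_of_hasDerivWithinAt hab hderiv
      (ContinuousOn.mul (fun q hq => (hderiv q hq).continuousWithinAt) hcont).neg
    pos := fun q _ => hpos q
    anti := antitoneOn_Icc_of_hasDerivWithinAt hderiv fun q hq =>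
      neg_nonpos.2 (mul_nonneg (hpos q).le (h0 q hq))
    ode := fun q hq _ => by
      rw [hderivWithin q hq, shadowSlope]
      ring
    bd_left := by simp [shadowPrice]
    bd_right := h.shadowPrice_right hu.ne'
    deriv_left := hzero a (left_mem_Icc.2 hab.le) h.excess_left
    deriv_right := hzero b (right_mem_Icc.2 hab.le) h.excess_right }

end FreeBoundary

/-- The fraction of wealth in the risky asset, valued at the stock price, that corresponds to the
shadow fraction `q`, which is valued at `κ q` times the stock price. -/
noncomputable def realFrac (κ : ℝ → ℝ) (q : ℝ) : ℝ := q / (κ q + (1 - κ q) * q)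

section realFrac

variable {κ : ℝ → ℝ} {q : ℝ}

theorem realFrac_eq_mobius (hκ : κ q ≠ 0) : realFrac κ q = mobius (1 / κ q) q := by
  have hden : 1 + (1 / κ q - 1) * q = (κ q + (1 - κ q) * q) / κ q := by
    field_simp
  rw [realFrac, mobius, hden, one_div_mul_eq_div, div_div_div_cancel_right₀ hκ]

theorem realFrac_eq_one_iff (hκ : κ q ≠ 0) (hden : κ q + (1 - κ q) * q ≠ 0) :
    realFrac κ q = 1 ↔ q = 1 := by
  rw [realFrac, div_eq_one_iff_eq hden, ← sub_eq_zero, ← sub_eq_zero (b := (1 : ℝ)),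
    show q - (κ q + (1 - κ q) * q) = κ q * (q - 1) by ring, mul_eq_zero, or_iff_right hκ]

theorem realFrac_mul_one_sub (hden : κ q + (1 - κ q) * q ≠ 0) :
    realFrac κ q * (1 - realFrac κ q) =
      κ q * (q * (1 - q)) / (κ q + (1 - κ q) * q) ^ 2 := by
  rw [realFrac, one_sub_div hden, div_mul_div_comm, ← sq]
  ring

theorem hasDerivWithinAt_realFrac {κ' : ℝ} {s : Set ℝ} (hκ : HasDerivWithinAt κ κ' s q)
    (hden : κ q + (1 - κ q) * q ≠ 0) : HasDerivWithinAt (realFrac κ)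
      ((κ q - q * (1 - q) * κ') / (κ q + (1 - κ q) * q) ^ 2) s q := by
  refine ((hasDerivWithinAt_id q s).div
    (hκ.add ((hκ.const_sub 1).mul (hasDerivWithinAt_id q s))) hden).congr_deriv ?_
  simp only [id, Pi.add_apply, Pi.mul_apply]
  ring

theorem deriv_mobius_realFrac (hκ : κ q ≠ 0) (hden : κ q + (1 - κ q) * q ≠ 0) :
    deriv (mobius (κ q)) (realFrac κ q) = (κ q + (1 - κ q) * q) ^ 2 / κ q := by
  have hpole : 1 + (κ q - 1) * realFrac κ q = κ q / (κ q + (1 - κ q) * q) := by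
    rw [realFrac, mul_div_assoc', eq_div_iff hden, add_mul, div_mul_cancel₀ _ hden]
    ring
  have hderiv := ((hasDerivAt_id (realFrac κ q)).const_mul (κ q)).div
    (((hasDerivAt_id (realFrac κ q)).const_mul (κ q - 1)).const_add 1)
    (by rw [id, hpole]; exact div_ne_zero hκ hden)
  refine hderiv.deriv.trans ?_
  simp only [id, hpole]
  rw [realFrac]
  field_simp
  ring

end realFrac

/-- The derivative of `realFrac κ` on `[a, b]`. -/
noncomputable def realFracDeriv (κ : ℝ → ℝ) (a b q : ℝ) : ℝ :=
  κ q * (1 + q * (1 - q) * logSlope κ a b q) / (κ q + (1 - κ q) * q) ^ 2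

namespace RelShadowPrice

variable {P : Params} {γu γd ξ a b q : ℝ} {n κ : ℝ → ℝ}

theorem mem_Icc (h : RelShadowPrice P γu γd a b n κ) (hq : q ∈ Icc a b) :
    κ q ∈ Icc (1 / γd) γu := by
  have hab := hq.1.trans hq.2
  exact ⟨h.bd_right.ge.trans (h.anti hq (right_mem_Icc.2 hab) hq.2),
    (h.anti (left_mem_Icc.2 hab) hq hq.1).trans h.bd_left.le⟩

theorem den_pos (h : RelShadowPrice P γu γd a b n κ) (hF : FreeBoundary P ξ a b n)
    (hP : P.Regular) (hd : 0 < γd) (hu : (γu - 1) * (2 * |P.qM| + 2) < 1)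
    (hd' : (γd - 1) * (2 * |P.qM| + 2) < 1) (hq : q ∈ Icc a b) : 0 < κ q + (1 - κ q) * q := by
  have hM : 0 < 2 * |P.qM| + 2 := by positivity
  have hκ := h.mem_Icc hq
  have hγd : 2 - γd ≤ 1 / γd := by
    rw [le_div_iff₀ hd]
    linarith [sq_nonneg (γd - 1)]
  have hκ1 : |1 - κ q| * (2 * |P.qM| + 2) < 1 := by
    rw [← lt_div_iff₀ hM] at hu hd' ⊢
    exact abs_lt.2 ⟨by linarith [hκ.2], by linarith [hκ.1]⟩
  have hq1 : |q - 1| ≤ 2 * |P.qM| + 2 := by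
    linarith [abs_sub q 1, hF.abs_q_le hP hq, abs_one (α := ℝ)]
  have hprod := (mul_le_mul_of_nonneg_left hq1 (abs_nonneg (1 - κ q))).trans_lt hκ1
  rw [← abs_mul] at hprod
  linarith [(abs_lt.1 hprod).1]

theorem one_add_mul_logSlope_eq (h : RelShadowPrice P γu γd a b n κ) (hF : FreeBoundary P ξ a b n)
    (hP : P.Regular) (hq : q ∈ Icc a b) (h1 : q ≠ 1) :
    1 + q * (1 - q) * logSlope κ a b q = q * (1 - q) / (q * (1 - q) - excess P n q) := by
  have hweight := hF.mul_one_sub_ne_zero hP hq h1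
  have hsub := hF.sub_excess_ne_zero hP hq h1
  rw [h.logSlope_eq hP hq h1, mul_div_assoc', mul_div_mul_left _ _ hweight,
    one_add_div hsub, sub_add_cancel]

theorem one_add_mul_logSlope_pos (h : RelShadowPrice P γu γd a b n κ)
    (hF : FreeBoundary P ξ a b n) (hP : P.Regular) (hq : q ∈ Icc a b) :
    0 < 1 + q * (1 - q) * logSlope κ a b q := by
  by_cases h1 : q = 1
  · simp [h1]
  · rw [h.one_add_mul_logSlope_eq hF hP hq h1]
    exact div_pos_iff.2 (mul_pos_iff.1 (hF.weight_pos hP hq h1))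

theorem hasDerivWithinAt_realFrac (h : RelShadowPrice P γu γd a b n κ) (hq : q ∈ Icc a b)
    (hden : κ q + (1 - κ q) * q ≠ 0) :
    HasDerivWithinAt (realFrac κ) (realFracDeriv κ a b q) (Icc a b) q := by
  refine (EpsteinZin.hasDerivWithinAt_realFrac
    (h.contDiff.differentiableOn one_ne_zero q hq).hasDerivWithinAt hden).congr_deriv ?_
  have := (h.pos q hq).ne'
  rw [realFracDeriv, logSlope]
  field_simp
  ring

theorem realFracDeriv_pos (h : RelShadowPrice P γu γd a b n κ) (hF : FreeBoundary P ξ a b n)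
    (hP : P.Regular) (hq : q ∈ Icc a b) (hden : κ q + (1 - κ q) * q ≠ 0) :
    0 < realFracDeriv κ a b q :=
  div_pos (mul_pos (h.pos q hq) (h.one_add_mul_logSlope_pos hF hP hq)) (sq_pos_of_ne_zero hden)

theorem continuousOn_realFracDeriv (h : RelShadowPrice P γu γd a b n κ) (hab : a < b)
    (hden : ∀ q ∈ Icc a b, κ q + (1 - κ q) * q ≠ 0) :
    ContinuousOn (realFracDeriv κ a b) (Icc a b) := by
  have hκ := h.contDiff.continuousOn
  have hslope := h.continuousOn_logSlope hab
  exact ContinuousOn.div (by fun_prop) (by fun_prop) fun q hq => pow_ne_zero 2 (hden q hq)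

theorem inv_realFracDeriv_eq (h : RelShadowPrice P γu γd a b n κ) (hF : FreeBoundary P ξ a b n)
    (hP : P.Regular) (hq : q ∈ Icc a b) (h1 : q ≠ 1) (hden : κ q + (1 - κ q) * q ≠ 0) :
    (realFracDeriv κ a b q)⁻¹ =
      (P.ell q - n q) / (P.ell (realFrac κ q) - P.m (realFrac κ q)) := by
  rw [realFracDeriv, h.one_add_mul_logSlope_eq hF hP hq h1, P.ell_sub_m, ← gap_mul_sub_excess hP,
    realFrac_mul_one_sub hden, mul_div_mul_left _ _ hP.gap_ne, mul_div_assoc', div_div, inv_div,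
    div_div_eq_mul_div, mul_comm]

theorem inv_realFracDeriv_eq_of_excess_eq_zero (h : RelShadowPrice P γu γd a b n κ)
    (hP : P.Regular) (hq : q ∈ Icc a b) (h0 : excess P n q = 0)
    (hden : κ q + (1 - κ q) * q ≠ 0) :
    (realFracDeriv κ a b q)⁻¹ =
      deriv (mobius (κ q)) (realFrac κ q) := by
  have hslope : q * (1 - q) * logSlope κ a b q = 0 := by
    by_cases h1 : q = 1
    · rw [h1, sub_self, mul_zero, zero_mul]
    · rw [h.logSlope_eq hP hq h1, h0, zero_div, mul_zero]
  rw [realFracDeriv, hslope, add_zero, mul_one, inv_div,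
    deriv_mobius_realFrac (h.pos q hq).ne' hden]

theorem exists_shadowFraction (h : RelShadowPrice P γu γd a b n κ) (hF : FreeBoundary P ξ a b n)
    (hP : P.Regular) (hden : ∀ q ∈ Icc a b, 0 < κ q + (1 - κ q) * q) :
    ∃ sf, mobius (1 / γu) a < mobius γd b ∧
      ShadowFraction P γu γd a b (mobius (1 / γu) a) (mobius γd b) n sf := by
  have hab := hF.lt hP
  have ha : a ∈ Icc a b := left_mem_Icc.2 hab.le
  have hb : b ∈ Icc a b := right_mem_Icc.2 hab.le
  have hκ : ∀ q ∈ Icc a b, κ q ≠ 0 := fun q hq => (h.pos q hq).ne'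
  have hderiv := fun q hq => h.hasDerivWithinAt_realFrac hq (hden q hq).ne'
  have hderiv_pos := fun q hq => h.realFracDeriv_pos hF hP hq (hden q hq).ne'
  have hderiv_cont := h.continuousOn_realFracDeriv hab fun q hq => (hden q hq).ne'
  have hleft : mobius (1 / γu) a = realFrac κ a := by
    rw [realFrac_eq_mobius (hκ a ha), h.bd_left]
  have hright : mobius γd b = realFrac κ b := by
    rw [realFrac_eq_mobius (hκ b hb), h.bd_right, one_div_one_div]
  have hlt := strictMonoOn_Icc_of_hasDerivWithinAt hderiv hderiv_pos ha hb hab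
  obtain ⟨sf, hmaps, hinv, hinv', hmono, hC1, hsf⟩ :=
    exists_contDiffOn_inverse_Icc hab hderiv hderiv_cont hderiv_pos
  have hderivWithin := fun p hp => (hsf p hp).derivWithin (uniqueDiffOn_Icc hlt p hp)
  have hboundary : ∀ q ∈ Icc a b, excess P n q = 0 →
      realFrac κ q ∈ Icc (realFrac κ a) (realFrac κ b) →
      derivWithin sf (Icc (realFrac κ a) (realFrac κ b)) (realFrac κ q) =
        deriv (mobius (κ q)) (realFrac κ q) := fun q hq h0 hp => by
    rw [hderivWithin _ hp, hinv' hq]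
    exact h.inv_realFracDeriv_eq_of_excess_eq_zero hP hq h0 (hden q hq).ne'
  rw [hleft, hright]
  exact ⟨sf, hlt, {
    contDiff := hC1
    mapsTo := hmaps
    mono := hmono
    ode := fun p hp hp1 => by
      have hq := hmaps hp
      have h1 : sf p ≠ 1 := fun h1 => hp1 <| (hinv hp).symm.trans <|
        (realFrac_eq_one_iff (hκ _ hq) (hden _ hq).ne').2 h1
      rw [hderivWithin p hp, h.inv_realFracDeriv_eq hF hP hq h1 (hden _ hq).ne', hinv hp]
    bd_left := hinv' ha
    bd_right := hinv' hb
    deriv_left := h.bd_left ▸ hboundary a ha hF.excess_left (left_mem_Icc.2 hlt.le)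
    deriv_right := h.bd_right ▸ hboundary b hb hF.excess_right (right_mem_Icc.2 hlt.le)
    at_one := fun h1 => (realFrac_eq_one_iff (hκ _ (hmaps h1)) (hden _ (hmaps h1)).ne').1
      (hinv h1) }⟩

end RelShadowPrice

namespace Params

variable {P : Params}

theorem regular_of_wellPosed (hσ : 0 < P.σ) (hR : 0 < P.R) (hS : 0 < P.S)
    (hwell : (P.R < 1 ∧ P.S < 1 ∧ 0 ≤ P.mM) ∨ (1 < P.R ∧ 1 < P.S ∧ 0 < P.mM))
    (hq0 : P.qM ≠ 0) (hq1 : P.qM ≠ 1) :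
    P.Regular ∧ 0 < P.gap * (1 - P.R) ∧ (0 < P.mM ∨ P.mM = 0 ∧ 0 < P.gap) := by
  have hσ2 : 0 < P.σ ^ 2 / 2 := by positivity
  rcases hwell with ⟨hR1, hS1, hm⟩ | ⟨hR1, hS1, hm⟩
  · have hgap : 0 < P.gap := mul_pos (div_pos (sub_pos.2 hS1) hS) hσ2
    exact ⟨⟨hσ, hR, hS, hR1.ne, hgap.ne', hq0, hq1⟩, mul_pos hgap (sub_pos.2 hR1),
      hm.lt_or_eq.imp_right fun h => ⟨h.symm, hgap⟩⟩
  · have hgap : P.gap < 0 := mul_neg_of_neg_of_pos (div_neg_of_neg_of_pos (sub_neg.2 hS1) hS) hσ2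
    exact ⟨⟨hσ, hR, hS, hR1.ne', hgap.ne, hq0, hq1⟩,
      mul_pos_of_neg_of_neg hgap (sub_neg.2 hR1), Or.inl hm⟩

end Params

theorem exists_solves {P : Params} (hP : P.Regular) (hsign : 0 < P.gap * (1 - P.R))
    (hm : 0 < P.mM ∨ P.mM = 0 ∧ 0 < P.gap) :
    ∃ ε₀ > 0, ∀ εu εd, 0 < εu → εu < ε₀ → 0 < εd → εd < ε₀ →
      ∃ D : ShadowData, D.Solves P (1 + εu) (1 + εd) := by
  obtain ⟨L₀, hL₀, hexcursion⟩ := hP.exists_isReducedExcursion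
  have hM : 0 < 2 * |P.qM| + 2 := by positivity
  refine ⟨min (L₀ / 2) (1 / (2 * |P.qM| + 2)), by positivity, fun εu εd hu hu' hd hd' => ?_⟩
  rw [lt_min_iff, lt_div_iff₀ hM] at hu' hd'
  have hγu : 0 < 1 + εu := by linarith
  have hγd : 0 < 1 + εd := by linarith
  have hpos : 0 < Real.log ((1 + εu) * (1 + εd)) :=
    Real.log_pos (one_lt_mul_of_lt_of_le (by linarith) (by linarith))
  have hlt : Real.log ((1 + εu) * (1 + εd)) < L₀ := by
    rw [Real.log_mul hγu.ne' hγd.ne']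
    linarith [Real.log_le_sub_one_of_pos hγu, Real.log_le_sub_one_of_pos hγd]
  obtain ⟨a, b, g, hg, hint⟩ := hexcursion _ hpos hlt
  have hF := hg.freeBoundary hP hsign hm (mul_pos hγu hγd) hint
  have hκ := hF.relShadowPrice hP hg.one_notMem (fun q hq => hg.shadowSlope_nonneg hP hq) hγu
  obtain ⟨sf, hsflt, hsf⟩ := hκ.exists_shadowFraction hF hP fun q hq =>
    hκ.den_pos hF hP hγd (by linarith) (by linarith) hq
  exact ⟨⟨a, b, _, _, sf⟩, hsflt, hF, hκ, hsf⟩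

end EpsteinZin

theorem proposition6p3 (P : EpsteinZin.Params)
    (hσ : 0 < P.σ) (hR : 0 < P.R) (hS : 0 < P.S)
    (hwell : (P.R < 1 ∧ P.S < 1 ∧ 0 ≤ P.mM) ∨ (1 < P.R ∧ 1 < P.S ∧ 0 < P.mM))
    (hq0 : P.qM ≠ 0) (hq1 : P.qM ≠ 1) :
    ∃ ε₀ : ℝ, 0 < ε₀ ∧ ∃ K : ℝ, ∀ εu εd : ℝ, 0 < εu → εu < ε₀ → 0 < εd → εd < ε₀ →
      (∃ D : EpsteinZin.ShadowData, D.Solves P (1 + εu) (1 + εd)) ∧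
      ∀ D : EpsteinZin.ShadowData, D.Solves P (1 + εu) (1 + εd) →
      ∀ ε : ℝ, ε = (1 + εu) * (1 + εd) - 1 →
      ∀ t x y φ p : ℝ, 0 ≤ t → EpsteinZin.Solvent (1 + εu) (1 + εd) x y φ →
        p = EpsteinZin.frac x y φ → p ∈ Set.Icc (D.pLow (1 + εu)) (D.pHigh (1 + εd)) →
        (0 < P.mM →
          |D.consumption t x y φ - P.consumption0 t x y φ *
              (1 + P.R * (1 - P.S) / P.S * (P.σ ^ 2 / (2 * P.mM))
                    * P.Delta ^ (2 / 3 : ℝ) * (εu + εd) ^ (2 / 3 : ℝ)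
                + P.qM / (2 * P.S)
                    * (1 - 1 / 2 * EpsteinZin.h3
                        ((p - P.qM) / (P.Delta ^ (1 / 3 : ℝ) * ε ^ (1 / 3 : ℝ)))) * (εu + εd)
                + P.qM / 2 * (εu - εd))|
            ≤ K * (x + y * φ) * ε ^ (4 / 3 : ℝ)) ∧
        (P.mM = 0 →
          |D.consumption t x y φ - (x + y * φ) * (P.R * (1 - P.S) / P.S * (P.σ ^ 2 / 2)
                    * P.Delta ^ (2 / 3 : ℝ) * (εu + εd) ^ (2 / 3 : ℝ))|
            ≤ K * (x + y * φ) * ε ^ (4 / 3 : ℝ)) := by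
  obtain ⟨hP, hsign, hm⟩ := EpsteinZin.Params.regular_of_wellPosed hσ hR hS hwell hq0 hq1
  obtain ⟨ε₁, hε₁, hexists⟩ := EpsteinZin.exists_solves hP hsign hm
  obtain ⟨ε₂, hε₂, K, hexpansion⟩ := EpsteinZin.exists_consumption_expansion hP
  refine ⟨min ε₁ ε₂, lt_min hε₁ hε₂, K, fun εu εd hu hu' hd hd' => ?_⟩
  rw [lt_min_iff] at hu' hd'
  refine ⟨hexists εu εd hu hu'.1 hd hd'.1, ?_⟩
  rintro D hD _ rfl t x y φ _ - hsolvent rfl hp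
  have hbound := hexpansion εu εd hu hu'.2 hd hd'.2 D hD t x y φ hsolvent hp
  refine ⟨fun hm => ?_, fun hm => ?_⟩
  · rwa [hP.mul_rateExpansion hm.ne'] at hbound
  · rwa [P.rateExpansion_of_mM_eq_zero hm] at hbound
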